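/- Let $S^2\subset\mathbb R^3$ be the unit sphere and $M=S^2\times S^2\times\mathbb R^2$, with points $(u,v,(q,p))$, $u=(u_1,u_2,u_3)$, $v=(v_1,v_2,v_3)$, $|u|=|v|=1$. The integral map of the special two-spin Tavis–Cummings (STC) system is $F=(H_1,H_2,K):M\to\mathbb R^3$, where $$H_1=(\delta_1-\omega)u_3+\sqrt2\,g\,(q u_1-p u_2)-\frac{2g^2}{\delta_2-\delta_1}(u_1v_1+u_2v_2+u_3v_3),$$ $$H_2=(\delta_2-\omega)v_3+\sqrt2\,g\,(q v_1-p v_2)+\frac{2g^2}{\delta_2-\delta_1}(u_1v_1+u_2v_2+u_3v_3),$$ $$K=u_3+v_3+\tfrac12(p^2+q^2),$$ with the parameter values $\delta_1=\tfrac12$, $\delta_2=\tfrac32$, $\omega=1$, $g=1$. A point $c\in M$ is singular if the differential $DF(c):T_cM\to\mathbb R^3$ has rank less than $3$, and a critical value is the image of a singular point. Let $R=F(M)\setminus\{\text{critical values of }F\}\subset\mathbb R^3$ be the set of regular values in the image of $F$, with the subspace topology. **Proposition.** The set $R$ is path-connected, and for each $r_0\in R$ the fundamental group $\pi_1(R,r_0)$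 is isomorphic to the free group on three generators, $\mathbf F_3=\mathbb Z*\mathbb Z*\mathbb Z$. -/

import Mathlib

open scoped Manifold

noncomputable section

namespace TavisCummings

/-- The unit sphere `S² ⊆ ℝ³`; coordinates `0, 1, 2` are the three spin components. -/
abbrev Sphere2 : Type := Metric.sphere (0 : EuclideanSpace ℝ (Fin 3)) 1

/-- The phase space `M = S² × S² × ℝ²`, where `ℝ²` with canonical coordinates `(q, p)` is
identified with `ℂ` by `z = p + i q`. -/
abbrev PhaseSpace : Type := Sphere2 × Sphere2 × ℂ

/-- The model with corners of the six-dimensional manifold `M`. -/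
abbrev phaseModel :=
  (𝓡 2).prod ((𝓡 2).prod 𝓘(ℝ, ℂ))

/-- The first spin `u = (u₁, u₂, u₃)` as a vector of `ℝ³`. -/
def spinU (m : PhaseSpace) : EuclideanSpace ℝ (Fin 3) := m.1

/-- The second spin `v = (v₁, v₂, v₃)` as a vector of `ℝ³`. -/
def spinV (m : PhaseSpace) : EuclideanSpace ℝ (Fin 3) := m.2.1

/-- The canonical coordinate `q`. -/
def coordQ (m : PhaseSpace) : ℝ := m.2.2.im

/-- The canonical coordinate `p`. -/
def coordP (m : PhaseSpace) : ℝ := m.2.2.re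

/-- The dot product `u₁ v₁ + u₂ v₂ + u₃ v₃` of the two spins. -/
def spinDot (m : PhaseSpace) : ℝ :=
  spinU m 0 * spinV m 0 + spinU m 1 * spinV m 1 + spinU m 2 * spinV m 2

/-- The momentum `K = u₃ + v₃ + (p² + q²) / 2` of the circle action. -/
def momentumK (m : PhaseSpace) : ℝ :=
  spinU m 2 + spinV m 2 + (coordP m ^ 2 + coordQ m ^ 2) / 2

/-- The integral `H₁` of the two-spin Tavis-Cummings system with parameters `δ₁, δ₂, ω, g`. -/
def integralH1 (δ₁ δ₂ ω g : ℝ) (m : PhaseSpace) : ℝ :=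
  (δ₁ - ω) * spinU m 2
    + √2 * g * (coordQ m * spinU m 0 - coordP m * spinU m 1)
    - 2 * g ^ 2 / (δ₂ - δ₁) * spinDot m

/-- The integral `H₂` of the two-spin Tavis-Cummings system with parameters `δ₁, δ₂, ω, g`. -/
def integralH2 (δ₁ δ₂ ω g : ℝ) (m : PhaseSpace) : ℝ :=
  (δ₂ - ω) * spinV m 2
    + √2 * g * (coordQ m * spinV m 0 - coordP m * spinV m 1)
    + 2 * g ^ 2 / (δ₂ - δ₁) * spinDot m

/-- The integral map `F = (H₁, H₂, K) : M → ℝ³` of the two-spin Tavis-Cummings system. -/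
def integralMap (δ₁ δ₂ ω g : ℝ) (m : PhaseSpace) : ℝ × ℝ × ℝ :=
  (integralH1 δ₁ δ₂ ω g m, integralH2 δ₁ δ₂ ω g m, momentumK m)

/-- The integral map of the special Tavis-Cummings (STC) system:
`δ₁ = 1/2`, `δ₂ = 3/2`, `ω = 1`, `g = 1`. -/
def stcMap : PhaseSpace → ℝ × ℝ × ℝ := integralMap (1 / 2) (3 / 2) 1 1

/-- The complex coordinate `u = u₁ + i u₂`. -/
def complexU (m : PhaseSpace) : ℂ := (spinU m 0 : ℂ) + Complex.I * (spinU m 1 : ℂ)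

/-- The complex coordinate `v = v₁ + i v₂`. -/
def complexV (m : PhaseSpace) : ℂ := (spinV m 0 : ℂ) + Complex.I * (spinV m 1 : ℂ)

open ComplexConjugate in
/-- `H₁` in complex coordinates. -/
theorem integralH1_complex (δ₁ δ₂ ω g : ℝ) (m : PhaseSpace) :
    (integralH1 δ₁ δ₂ ω g m : ℂ) =
      (δ₁ - ω) * spinU m 2
        + Complex.I / (√2 : ℝ) * g
          * (complexU m * conj m.2.2 - conj (complexU m) * m.2.2)
        - g ^ 2 / (δ₂ - δ₁)
          * (complexU m * conj (complexV m) + conj (complexU m) * complexV m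
            + 2 * spinU m 2 * spinV m 2) := by
  have h2 : ((√2 : ℝ) : ℂ) * ((√2 : ℝ) : ℂ) = 2 := by
    rw [← Complex.ofReal_mul, Real.mul_self_sqrt (by norm_num)]; norm_num
  have h0 : ((√2 : ℝ) : ℂ) ≠ 0 := by simp
  have hz : m.2.2 = (coordP m : ℂ) + coordQ m * Complex.I := (Complex.re_add_im _).symm
  have hI : Complex.I ^ 2 = -1 := Complex.I_sq
  have hd : Complex.I / ((√2 : ℝ) : ℂ) = Complex.I * ((√2 : ℝ) : ℂ) / 2 := by
    rw [div_eq_div_iff h0 two_ne_zero]; linear_combination -Complex.I * h2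
  rw [hz, hd]
  simp only [integralH1, spinDot, complexU, complexV, map_add, map_mul, Complex.conj_ofReal,
    Complex.conj_I]
  push_cast
  ring_nf
  simp only [hI]
  ring

open ComplexConjugate in
/-- `H₂` in complex coordinates. -/
theorem integralH2_complex (δ₁ δ₂ ω g : ℝ) (m : PhaseSpace) :
    (integralH2 δ₁ δ₂ ω g m : ℂ) =
      (δ₂ - ω) * spinV m 2
        + Complex.I / (√2 : ℝ) * g
          * (complexV m * conj m.2.2 - conj (complexV m) * m.2.2)
        + g ^ 2 / (δ₂ - δ₁)
          * (complexU m * conj (complexV m) + conj (complexU m) * complexV m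
            + 2 * spinU m 2 * spinV m 2) := by
  have h2 : ((√2 : ℝ) : ℂ) * ((√2 : ℝ) : ℂ) = 2 := by
    rw [← Complex.ofReal_mul, Real.mul_self_sqrt (by norm_num)]; norm_num
  have h0 : ((√2 : ℝ) : ℂ) ≠ 0 := by simp
  have hz : m.2.2 = (coordP m : ℂ) + coordQ m * Complex.I := (Complex.re_add_im _).symm
  have hI : Complex.I ^ 2 = -1 := Complex.I_sq
  have hd : Complex.I / ((√2 : ℝ) : ℂ) = Complex.I * ((√2 : ℝ) : ℂ) / 2 := by
    rw [div_eq_div_iff h0 two_ne_zero]; linear_combination -Complex.I * h2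
  rw [hz, hd]
  simp only [integralH2, spinDot, complexU, complexV, map_add, map_mul, Complex.conj_ofReal,
    Complex.conj_I]
  push_cast
  ring_nf
  simp only [hI]
  ring

/-- The rank of the differential `DF(m) : T_m M → ℝ³` of a map on the phase space. -/
def differentialRank (F : PhaseSpace → ℝ × ℝ × ℝ) (m : PhaseSpace) : ℕ :=
  Module.finrank ℝ (mfderiv phaseModel 𝓘(ℝ, ℝ × ℝ × ℝ) F m).range

/-- `m` is a singular (critical) point of `F` if `DF(m)` has rank less than three. -/
def IsSingularPoint (F : PhaseSpace → ℝ × ℝ × ℝ) (m : PhaseSpace) : Prop :=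
  differentialRank F m < 3

/-- The critical values of `F`: the images of its singular points. -/
def criticalValues (F : PhaseSpace → ℝ × ℝ × ℝ) : Set (ℝ × ℝ × ℝ) :=
  F '' {m | IsSingularPoint F m}

/-- The regular values of `F`: the values that `F` takes and that are not critical values, so that
points with an empty fibre are not regular values. -/
def regularValues (F : PhaseSpace → ℝ × ℝ × ℝ) : Set (ℝ × ℝ × ℝ) :=
  Set.range F \ criticalValues F

end TavisCummings

end

/-! The Lax vector `lax m z` is polynomial in a complex parameter `z`, and the sum of the squares of
its components depends on `m` only through `stcMap m`: it is `spectral (stcMap m) z`. After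
rescaling, this is four times a `sextic` whose three coefficients are the affine coordinates
`parameters` of the value. A point is singular exactly when its Lax vector vanishes at some `z`. One
direction differentiates the sum of squares; the other turns an annihilating covector into a
polynomial vector of smaller degree parallel to the Lax vector. A zero of the Lax vector is a double
root of the sextic. Conversely, a positive sextic is a sum of two squares, which yields a point of
the fibre with planar spins; when there is a double root, the two squares can be given a common
zero. So `R` corresponds to the everywhere positive sextics without multiple complex root
(`mem_regularValues_iff`).

The positive sextics form an open convex set in three-space. A double root of one of them is not
real, so the sextic is the square of a quadratic times a quadratic. Comparing coefficients leaves
two curves (`hasDoubleRoot_cases`): the even sextics, in the plane `s = 0`, and a curve symmetric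
under `s ↦ -s`. They meet only at `s = y = 0`, `t = 3`, and both ends of each leave the convex set.
The complement thus looks like a ball without two crossing diameters, that is, like a sphere with
four punctures, which explains the three generators.

Both curves are graphs of `t` over curves in the `(s, y)`-plane. This gives a cover by the part
above them and the part below them. Each part has interval fibres over a star-shaped planar region,
so it is simply connected; the intersection has four path connected components (`quadrant`). Van
Kampen's theorem (`SimplyConnectedPair.nonempty_mulEquiv`) then gives the free group with one
generator fewer than there are components. -/

/-- The corestriction of a path to a set containing it. -/
def Path.corestrict {X : Type*} [TopologicalSpace X] {V : Set X} {x y : X} (γ : Path x y)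
    (h : ∀ t, γ t ∈ V) :
    Path (⟨x, by simpa using h 0⟩ : V) (⟨y, by simpa using h 1⟩ : V) where
  toFun t := ⟨γ t, h t⟩
  continuous_toFun := by fun_prop
  source' := by simp
  target' := by simp

theorem IsSimplyConnected.mk_eq_mk {X : Type*} [TopologicalSpace X] {V : Set X}
    (hV : IsSimplyConnected V) {x y : X} (γ γ' : Path x y) (h : ∀ t, γ t ∈ V)
    (h' : ∀ t, γ' t ∈ V) : Path.Homotopic.Quotient.mk γ = Path.Homotopic.Quotient.mk γ' := by
  have := hV.simplyConnectedSpace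
  have key := (SimplyConnectedSpace.paths_homotopic (γ.corestrict h) (γ'.corestrict h')).map
    ⟨Subtype.val, continuous_subtype_val⟩
  exact Path.Homotopic.Quotient.eq.2 key

/-! ### Van Kampen's theorem for two simply connected open sets -/

/-- A cover of a space by two simply connected open sets `V true`, `V false` whose intersection
is the disjoint union of path connected open sets `W i`, `i : Option J`. -/
structure SimplyConnectedPair (X : Type*) [TopologicalSpace X] (J : Type*) where
  V : Bool → Set X
  isOpen_V : ∀ b, IsOpen (V b)
  cover : ∀ x, ∃ b, x ∈ V b
  isSimplyConnected_V : ∀ b, IsSimplyConnected (V b)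
  W : Option J → Set X
  isOpen_W : ∀ i, IsOpen (W i)
  isPathConnected_W : ∀ i, IsPathConnected (W i)
  mem_iff : ∀ x, (∀ b, x ∈ V b) ↔ ∃ i, x ∈ W i
  disjoint_W : ∀ i j x, x ∈ W i → x ∈ W j → i = j

namespace SimplyConnectedPair

variable {X : Type*} [TopologicalSpace X] {J : Type*} (S : SimplyConnectedPair X J)

/-- The base point, taken in `W none`. -/
noncomputable def base : X := (S.isPathConnected_W none).nonempty.choose

theorem base_mem_W : S.base ∈ S.W none := (S.isPathConnected_W none).nonempty.choose_spec

theorem base_mem (b : Bool) : S.base ∈ S.V b := (S.mem_iff _).2 ⟨_, S.base_mem_W⟩ b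

/-- The homotopy class of the paths in `V b` from the base point to `x`. -/
noncomputable def ray (b : Bool) {x : X} (hx : x ∈ S.V b) : Path.Homotopic.Quotient S.base x :=
  .mk ((S.isSimplyConnected_V b).isPathConnected.joinedIn _ (S.base_mem b) _ hx).somePath

theorem ray_eq_mk (b : Bool) {x : X} (hx : x ∈ S.V b) (γ : Path S.base x)
    (hγ : ∀ t, γ t ∈ S.V b) : S.ray b hx = .mk γ :=
  (S.isSimplyConnected_V b).mk_eq_mk _ _ (JoinedIn.somePath_mem _) hγ

theorem ray_base (b : Bool) : S.ray b (S.base_mem b) = .refl _ := by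
  rw [S.ray_eq_mk b (S.base_mem b) (Path.refl _) (fun _ => S.base_mem b)]
  rfl

theorem ray_trans (b : Bool) {x y : X} (hx : x ∈ S.V b) (hy : y ∈ S.V b) (γ : Path x y)
    (hγ : ∀ t, γ t ∈ S.V b) : (S.ray b hx).trans (.mk γ) = S.ray b hy := by
  have h := (S.isSimplyConnected_V b).isPathConnected.joinedIn _ (S.base_mem b) _ hx
  rw [S.ray_eq_mk b hx h.somePath h.somePath_mem, ← Path.Homotopic.Quotient.mk_trans]
  refine (S.ray_eq_mk b hy _ fun t => ?_).symm
  have := Set.mem_range_self (f := h.somePath.trans γ) t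
  rw [Path.trans_range] at this
  rcases this with ⟨t, ht⟩ | ⟨t, ht⟩
  · exact ht ▸ h.somePath_mem t
  · exact ht ▸ hγ t

/-- The loop that goes to `x` through `V true` and comes back through `V false`. -/
noncomputable def loop {x : X} (hx : ∀ b, x ∈ S.V b) : FundamentalGroup X S.base :=
  FundamentalGroup.fromPath ((S.ray true (hx true)).trans (S.ray false (hx false)).symm)

theorem loop_trans {x : X} (hx : ∀ b, x ∈ S.V b) :
    (S.loop hx).toPath.trans (S.ray false (hx false)) = S.ray true (hx true) := by
  change ((S.ray true (hx true)).trans (S.ray false (hx false)).symm).trans _ = _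
  simp

/-- The relation of `loop_trans` determines the loop, because `ray false` can be cancelled.
Equalities of loops are proved in this way. -/
theorem eq_loop {x : X} (hx : ∀ b, x ∈ S.V b) (g : FundamentalGroup X S.base)
    (h : g.toPath.trans (S.ray false (hx false)) = S.ray true (hx true)) : g = S.loop hx := by
  change g.toPath = (S.ray true (hx true)).trans (S.ray false (hx false)).symm
  rw [← h]
  simp

/-- A path inside `W i` prolongs both rays at once, so it cancels between the way out and the way
back. -/
theorem loop_eq_of_mem_W {i : Option J} {x y : X} (hx : x ∈ S.W i) (hy : y ∈ S.W i) :
    S.loop ((S.mem_iff x).2 ⟨i, hx⟩) = S.loop ((S.mem_iff y).2 ⟨i, hy⟩) := by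
  have h := (S.isPathConnected_W i).joinedIn _ hx _ hy
  have hb (b : Bool) := S.ray_trans b ((S.mem_iff x).2 ⟨i, hx⟩ b) ((S.mem_iff y).2 ⟨i, hy⟩ b)
    h.somePath fun t => (S.mem_iff _).2 ⟨i, h.somePath_mem t⟩ b
  apply S.eq_loop
  rw [← hb true, ← hb false, ← S.loop_trans, Path.Homotopic.Quotient.trans_assoc]

/-- The component of the base point contributes no generator; hence `J`, not `Option J`, indexes the
free group. -/
theorem loop_eq_one {x : X} (hx : x ∈ S.W none) : S.loop ((S.mem_iff x).2 ⟨_, hx⟩) = 1 := by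
  rw [S.loop_eq_of_mem_W hx S.base_mem_W]
  symm
  apply S.eq_loop
  rw [S.ray_base, S.ray_base]
  exact Path.Homotopic.Quotient.trans_refl _

/-- The loop through `W (some j)`. -/
noncomputable def gen (j : J) : FundamentalGroup X S.base :=
  S.loop ((S.mem_iff (S.isPathConnected_W (some j)).nonempty.choose).2
    ⟨_, (S.isPathConnected_W (some j)).nonempty.choose_spec⟩)

/-- The homomorphism from the free group that maps the generators to the loops `gen j`. -/
noncomputable def ofFree : FreeGroup J →* FundamentalGroup X S.base :=
  FreeGroup.lift S.gen

theorem loop_mem_range {x : X} (hx : ∀ b, x ∈ S.V b) : S.loop hx ∈ S.ofFree.range := by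
  obtain ⟨i, hi⟩ := (S.mem_iff x).1 hx
  cases i with
  | none => exact S.loop_eq_one hi ▸ one_mem _
  | some j =>
    refine ⟨FreeGroup.of j, ?_⟩
    rw [ofFree, FreeGroup.lift_apply_of, gen]
    exact S.loop_eq_of_mem_W (S.isPathConnected_W (some j)).nonempty.choose_spec hi

/-- The path class `p` is the composition of an element of the image of the free group and
of the class of the paths in one of the two open sets. -/
def Reaches {y : X} (p : Path.Homotopic.Quotient S.base y) : Prop :=
  ∀ b, ∀ hy : y ∈ S.V b, ∃ g ∈ S.ofFree.range,
    p = (FundamentalGroup.toPath g).trans (S.ray b hy)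

/-- Passing from one open set to the other costs the loop at `y`, which lies in the image of the
free group. -/
theorem reaches_of_exists {y : X} {p : Path.Homotopic.Quotient S.base y} {b : Bool}
    (hy : y ∈ S.V b) {g : FundamentalGroup X S.base} (hg : g ∈ S.ofFree.range)
    (h : p = (FundamentalGroup.toPath g).trans (S.ray b hy)) : S.Reaches p := by
  intro b' hy'
  by_cases hb : b' = b
  · subst hb
    exact ⟨g, hg, h⟩
  have hx : ∀ c, y ∈ S.V c := by
    intro c
    cases b <;> cases b' <;> cases c <;> simp_all
  cases b' with
  | false =>
    obtain rfl : b = true := by cases b <;> simp_all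
    -- In this fundamental group the right factor of a product is traversed first.
    refine ⟨S.loop hx * g, mul_mem (S.loop_mem_range hx) hg, ?_⟩
    rw [h, ← S.loop_trans hx, ← Path.Homotopic.Quotient.trans_assoc]
    rfl
  | true =>
    obtain rfl : b = false := by cases b <;> simp_all
    refine ⟨(S.loop hx)⁻¹ * g, mul_mem (inv_mem (S.loop_mem_range hx)) hg, ?_⟩
    have : S.ray false hy = ((S.loop hx)⁻¹).toPath.trans (S.ray true hy') := by
      rw [← S.loop_trans hx, ← Path.Homotopic.Quotient.trans_assoc]
      have h1 : ((S.loop hx)⁻¹).toPath.trans (S.loop hx).toPath = .refl _ := by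
        change S.loop hx * (S.loop hx)⁻¹ = 1
        exact mul_inv_cancel _
      rw [h1, Path.Homotopic.Quotient.refl_trans]
    rw [h, this, ← Path.Homotopic.Quotient.trans_assoc]
    rfl

theorem Reaches.trans {x y : X} {p : Path.Homotopic.Quotient S.base x} (hp : S.Reaches p)
    (b : Bool) (γ : Path x y) (hγ : ∀ t, γ t ∈ S.V b) : S.Reaches (p.trans (.mk γ)) := by
  have hx : x ∈ S.V b := by simpa using hγ 0
  have hy : y ∈ S.V b := by simpa using hγ 1
  obtain ⟨g, hg, h⟩ := hp b hx
  refine S.reaches_of_exists hy hg ?_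
  rw [h, Path.Homotopic.Quotient.trans_assoc, S.ray_trans b hx hy γ hγ]

theorem reaches_refl : S.Reaches (.refl S.base) := by
  refine S.reaches_of_exists (S.base_mem true) (one_mem _) ?_
  rw [S.ray_base]
  exact (Path.Homotopic.Quotient.trans_refl _).symm

/-- Induction along a subdivision of the path each of whose pieces stays in one of the two open
sets. -/
theorem Reaches.trans_subpath {x y : X} (γ : Path x y) (t : ℕ → unitInterval) (tmono : Monotone t)
    (ht : ∀ n, ∃ b, Set.Icc (t n) (t (n + 1)) ⊆ γ ⁻¹' S.V b)
    {p : Path.Homotopic.Quotient S.base (γ (t 0))} (hp : S.Reaches p) (n : ℕ) :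
    S.Reaches (p.trans (.mk (γ.subpath (t 0) (t n)))) := by
  induction n with
  | zero =>
    rw [Path.subpath_self, Path.Homotopic.Quotient.mk_refl, Path.Homotopic.Quotient.trans_refl]
    exact hp
  | succ n ih =>
    obtain ⟨b, hb⟩ := ht n
    have := ih.trans S b (γ.subpath (t n) (t (n + 1))) (fun s => by
      have := Set.mem_range_self (f := γ.subpath (t n) (t (n + 1))) s
      rw [Path.range_subpath_of_le _ _ _ (tmono n.le_succ)] at this
      obtain ⟨r, hr, e⟩ := this
      exact e ▸ hb hr)
    rw [Path.Homotopic.Quotient.trans_assoc, ← Path.Homotopic.Quotient.mk_trans] at this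
    rwa [← Path.Homotopic.Quotient.eq.2 ⟨Path.Homotopy.subpathTransSubpath γ _ _ _⟩]

theorem Reaches.trans_mk {x y : X} {p : Path.Homotopic.Quotient S.base x} (hp : S.Reaches p)
    (γ : Path x y) : S.Reaches (p.trans (.mk γ)) := by
  obtain ⟨t, t0, tmono, ⟨N, hN⟩, ht⟩ := exists_monotone_Icc_subset_open_cover_unitInterval
    (c := fun b => γ ⁻¹' S.V b) (fun b => (S.isOpen_V b).preimage γ.continuous)
    (fun s _ => by simpa using S.cover (γ s))
  have t1 : t N = 1 := hN N le_rfl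
  have key := fun p hp => Reaches.trans_subpath S γ t tmono ht (p := p) hp N
  rw [t0, t1, Path.subpath_zero_one] at key
  -- Makes the endpoints definitionally the values of the path at 0 and 1, so that `key` applies.
  obtain ⟨f, rfl, rfl⟩ := γ
  exact key p hp

theorem ofFree_surjective : Function.Surjective S.ofFree := by
  intro p
  obtain ⟨γ, rfl⟩ := Path.Homotopic.Quotient.mk_surjective (FundamentalGroup.toPath p)
  obtain ⟨g, ⟨w, hw⟩, h⟩ := S.reaches_refl.trans_mk S γ true (S.base_mem true)
  rw [Path.Homotopic.Quotient.refl_trans, S.ray_base] at h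
  refine ⟨w, hw.trans (Eq.symm (h.trans ?_))⟩
  exact Path.Homotopic.Quotient.trans_refl _

/-! ### The covering space with fibre the free group -/

open Classical in
/-- The index of the component of the intersection that contains `x`. -/
noncomputable def comp (x : X) : Option J :=
  if h : ∃ i, x ∈ S.W i then h.choose else none

theorem comp_eq {i : Option J} {x : X} (hx : x ∈ S.W i) : S.comp x = i := by
  have h : ∃ i, x ∈ S.W i := ⟨i, hx⟩
  rw [comp, dif_pos h]
  exact S.disjoint_W _ _ x h.choose_spec hx

/-- The transition element of the covering space at `x`. -/
noncomputable def transition (x : X) : FreeGroup J := (S.comp x).elim 1 FreeGroup.of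

/-- The sets `W i` are open, so `comp` is locally constant on the intersection. Its default value
elsewhere plays no role. -/
theorem continuousOn_of_comp {A Z : Type*} [TopologicalSpace A] [TopologicalSpace Z]
    (f : Option J → A → Z) (hf : ∀ i, Continuous (f i)) :
    ContinuousOn (fun p : X × A => f (S.comp p.1) p.2) {p | ∀ b, p.1 ∈ S.V b} := by
  intro p hp
  obtain ⟨i, hi⟩ := (S.mem_iff p.1).1 hp
  refine ContinuousAt.continuousWithinAt ?_
  refine ((hf i).comp continuous_snd).continuousAt.congr ?_
  filter_upwards [((S.isOpen_W i).preimage continuous_fst).mem_nhds (x := p) hi] with q hq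
  simp [S.comp_eq hq]

open Classical in
/-- The covering space with fibre the free group, trivial over `V true` and over `V false`. -/
noncomputable def core [TopologicalSpace (FreeGroup J)] [DiscreteTopology (FreeGroup J)] :
    FiberBundleCore Bool X (FreeGroup J) where
  baseSet := S.V
  isOpen_baseSet := S.isOpen_V
  indexAt x := (S.cover x).choose
  mem_baseSet_at x := (S.cover x).choose_spec
  coordChange b c x v := match b, c with
    | true, false => S.transition x * v
    | false, true => (S.transition x)⁻¹ * v
    | _, _ => v
  coordChange_self b x _ v := by cases b <;> rfl
  continuousOn_coordChange b c := by
    have h1 := S.continuousOn_of_comp (A := FreeGroup J)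
      (fun i v => i.elim 1 FreeGroup.of * v) (fun i => continuous_of_discreteTopology)
    have h2 := S.continuousOn_of_comp (A := FreeGroup J)
      (fun i v => (i.elim 1 FreeGroup.of)⁻¹ * v) (fun i => continuous_of_discreteTopology)
    cases b <;> cases c
    · exact continuousOn_snd
    · exact h2.mono fun p hp b => by cases b; exacts [hp.1.1, hp.1.2]
    · exact h1.mono fun p hp b => by cases b; exacts [hp.1.2, hp.1.1]
    · exact continuousOn_snd
  coordChange_comp b c d x _ v := by cases b <;> cases c <;> cases d <;> simp

section Covering

variable [TopologicalSpace (FreeGroup J)] [DiscreteTopology (FreeGroup J)]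

theorem isCoveringMap_proj : IsCoveringMap S.core.proj :=
  FiberBundle.isCoveringMap (F := FreeGroup J) (E := S.core.Fiber)

/-- The point of the covering space over `x` with coordinate `v` in the chart over `V b`. -/
noncomputable def point (b : Bool) (x : X) (v : FreeGroup J) : S.core.proj ⁻¹' {x} :=
  ⟨⟨x, S.core.coordChange b (S.core.indexAt x) x v⟩, rfl⟩

/-- A path inside `V b` lifts with constant coordinate in the chart over `V b`, and lifts are
unique. -/
theorem monodromy_mk (b : Bool) {x y : X} (γ : Path x y) (hγ : ∀ t, γ t ∈ S.V b)
    (v : FreeGroup J) :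
    S.isCoveringMap_proj.monodromy (.mk γ) (S.point b x v) = S.point b y v := by
  let Γ : C(unitInterval, S.core.TotalSpace) :=
    ⟨fun t => (S.core.localTriv b).toOpenPartialHomeomorph.symm (γ t, v), by
      refine (S.core.localTriv b).toOpenPartialHomeomorph.continuousOn_symm.comp_continuous
        (by fun_prop) fun t => ?_
      exact ⟨hγ t, Set.mem_univ _⟩⟩
  have hΓ (t) : Γ t = (S.point b (γ t) v).1 := rfl
  have h0 : γ.toContinuousMap 0 = S.core.proj (S.point b x v).1 := γ.source
  have := (S.isCoveringMap_proj.eq_liftPath_iff' (γ := γ.toContinuousMap)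
    (e := (S.point b x v).1) h0 (Γ := Γ)).2
    ⟨rfl, by rw [hΓ, γ.source]⟩
  refine Subtype.ext ?_
  change S.isCoveringMap_proj.liftPath γ.toContinuousMap (S.point b x v).1 _ 1 = _
  rw [← this, hΓ, γ.target]

theorem monodromy_ray (b : Bool) {x : X} (hx : x ∈ S.V b) (v : FreeGroup J) :
    S.isCoveringMap_proj.monodromy (S.ray b hx) (S.point b S.base v) = S.point b x v :=
  S.monodromy_mk b _ (JoinedIn.somePath_mem _) v

theorem point_true {i : Option J} {x : X} (hx : x ∈ S.W i) (v : FreeGroup J) :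
    S.point true x v = S.point false x (i.elim 1 FreeGroup.of * v) := by
  refine Subtype.ext (congrArg (Bundle.TotalSpace.mk x) ?_)
  have h := (S.mem_iff x).2 ⟨i, hx⟩
  have := S.core.coordChange_comp true false (S.core.indexAt x) x
    ⟨⟨h true, h false⟩, S.core.mem_baseSet_at x⟩ v
  rw [← this]
  change _ = S.core.coordChange _ _ _ _
  congr 1
  change S.transition x * v = _
  rw [transition, S.comp_eq hx]

theorem point_injective {b : Bool} {x : X} (hx : x ∈ S.V b) {v w : FreeGroup J}
    (h : S.point b x v = S.point b x w) : v = w := by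
  have h1 := congrArg (fun p : S.core.proj ⁻¹' {x} => (S.core.localTriv b p.1).2) h
  have this (u : FreeGroup J) : (S.core.localTriv b (S.point b x u).1).2 = u := by
    have := S.core.coordChange_comp b (S.core.indexAt x) b x
      ⟨⟨hx, S.core.mem_baseSet_at x⟩, hx⟩ u
    exact this.trans (S.core.coordChange_self b x hx u)
  exact (this v).symm.trans (h1.trans (this w))

/-- Along each ray the coordinate is constant. The change of chart over `W (some j)` multiplies it
by the generator, and the change at the base point is trivial. -/
theorem monodromy_gen (j : J) (v : FreeGroup J) :
    S.isCoveringMap_proj.monodromyPerm S.base (S.gen j) (S.point true S.base v)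
      = S.point true S.base (FreeGroup.of j * v) := by
  have hc := (S.isPathConnected_W (some j)).nonempty.choose_spec
  have hx := (S.mem_iff _).2 ⟨_, hc⟩
  have e : (S.gen j).toPath.trans (S.ray false (hx false)) = S.ray true (hx true) :=
    S.loop_trans hx
  have h1 := S.monodromy_ray true (hx true) v
  rw [← e, IsCoveringMap.monodromy_trans_apply, S.point_true hc v,
    ← S.monodromy_ray false (hx false)] at h1
  have h2 := (S.isCoveringMap_proj.monodromy_bijective (S.ray false (hx false))).injective h1
  refine h2.trans ?_
  rw [S.point_true S.base_mem_W]
  simp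

theorem monodromy_ofFree (w v : FreeGroup J) :
    S.isCoveringMap_proj.monodromyPerm S.base (S.ofFree w) (S.point true S.base v)
      = S.point true S.base (w * v) := by
  induction w using FreeGroup.induction_on generalizing v with
  | C1 => rw [map_one, map_one, one_mul, Equiv.Perm.one_apply]
  | of j =>
    rw [ofFree, FreeGroup.lift_apply_of]
    exact S.monodromy_gen j v
  | inv_of j ih =>
    rw [map_inv, map_inv, Equiv.Perm.inv_eq_iff_eq, ih, mul_inv_cancel_left]
  | mul x y hx hy => rw [map_mul, map_mul, Equiv.Perm.mul_apply, hy, hx, mul_assoc]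

end Covering

/-- The loop of a word `w` carries the point with coordinate 1 to the point with coordinate `w`; the
trivial loop fixes it. -/
theorem ofFree_injective : Function.Injective S.ofFree := by
  let _ : TopologicalSpace (FreeGroup J) := ⊥
  have : DiscreteTopology (FreeGroup J) := ⟨rfl⟩
  rw [injective_iff_map_eq_one]
  intro w hw
  have := S.monodromy_ofFree w 1
  rw [hw, map_one, mul_one] at this
  exact (S.point_injective (S.base_mem true) this).symm

theorem pathConnectedSpace {J : Type*} (S : SimplyConnectedPair X J) : PathConnectedSpace X := by
  rw [pathConnectedSpace_iff_univ]
  refine ⟨S.base, Set.mem_univ _, fun {y} _ => ?_⟩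
  obtain ⟨b, hb⟩ := S.cover y
  exact ((S.isSimplyConnected_V b).isPathConnected.joinedIn _ (S.base_mem b) _ hb).mono
    (Set.subset_univ _)

/-- Van Kampen's theorem for a cover by two simply connected open sets. -/
theorem nonempty_mulEquiv {J : Type*} (S : SimplyConnectedPair X J) (x : X) : Nonempty (FundamentalGroup X x ≃* FreeGroup J) := by
  have := S.pathConnectedSpace
  exact ⟨(FundamentalGroup.fundamentalGroupMulEquivOfPathConnected x S.base).trans
    (MulEquiv.ofBijective S.ofFree ⟨S.ofFree_injective, S.ofFree_surjective⟩).symm⟩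

end SimplyConnectedPair

/-! ### Open sets with convex fibres -/

section ConvexFibres

variable {B : Type*} [MetricSpace B] {E : Set (B × ℝ)}

/-- An open set with convex fibres over its projection has a continuous section. -/
theorem exists_section_of_convex_fibres (hE : IsOpen E)
    (hconv : ∀ b, Convex ℝ {r | (b, r) ∈ E}) :
    ∃ σ : C(Prod.fst '' E, ℝ), ∀ b, (b.1, σ b) ∈ E := by
  -- Since `E` is open, a constant section works locally; convexity of the fibres permits averaging
  -- by a partition of unity.
  refine exists_continuous_forall_mem_convex_of_local_const
    (t := fun b : Prod.fst '' E => {r | (b.1, r) ∈ E}) (fun b => hconv b) ?_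
  rintro ⟨_, ⟨b, r⟩, hbr, rfl⟩
  refine ⟨r, ?_⟩
  have : Continuous fun y : Prod.fst '' E => (y.1, r) := by fun_prop
  exact this.continuousAt.eventually (hE.mem_nhds hbr)

/-- An open set with convex fibres is homotopy equivalent to its projection. -/
theorem nonempty_homotopyEquiv_of_convex_fibres (hE : IsOpen E)
    (hconv : ∀ b, Convex ℝ {r | (b, r) ∈ E}) :
    Nonempty (ContinuousMap.HomotopyEquiv E (Prod.fst '' E)) := by
  obtain ⟨σ, hσ⟩ := exists_section_of_convex_fibres hE hconv
  let π : C(E, Prod.fst '' E) := ⟨fun p => ⟨p.1.1, p.1, p.2, rfl⟩, by fun_prop⟩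
  let ι : C(Prod.fst '' E, E) := ⟨fun b => ⟨(b.1, σ b), hσ b⟩, by fun_prop⟩
  -- The homotopy contracts each fibre to the section along segments.
  have hmem (x : unitInterval × E) :
      (x.2.1.1, (1 - (x.1 : ℝ)) * σ (π x.2) + x.1 * x.2.1.2) ∈ E :=
    hconv x.2.1.1 (hσ (π x.2)) x.2.2 (by linarith [x.1.2.2]) x.1.2.1 (by ring)
  refine ⟨⟨π, ι, ⟨⟨⟨fun x => ⟨_, hmem x⟩, by fun_prop⟩, fun p => ?_, fun p => ?_⟩⟩, ?_⟩⟩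
  · refine Subtype.ext (Prod.ext rfl ?_)
    simp [ι]
  · refine Subtype.ext (Prod.ext rfl ?_)
    simp
  · have : π.comp ι = ContinuousMap.id _ := by ext; rfl
    rw [this]

theorem IsOpen.isSimplyConnected_of_convex_fibres (hE : IsOpen E)
    (hconv : ∀ b, Convex ℝ {r | (b, r) ∈ E}) (hB : ContractibleSpace (Prod.fst '' E)) :
    IsSimplyConnected E := by
  obtain ⟨e⟩ := nonempty_homotopyEquiv_of_convex_fibres hE hconv
  exact e.simplyConnectedSpace

theorem IsOpen.isPathConnected_of_convex_fibres (hE : IsOpen E)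
    (hconv : ∀ b, Convex ℝ {r | (b, r) ∈ E}) (hB : IsPathConnected (Prod.fst '' E)) :
    IsPathConnected E := by
  obtain ⟨σ, hσ⟩ := exists_section_of_convex_fibres hE hconv
  have := isPathConnected_iff_pathConnectedSpace.1 hB
  have hfib (p : B × ℝ) (hp : p ∈ E) :
      JoinedIn E p (p.1, σ ⟨p.1, p, hp, rfl⟩) := by
    refine JoinedIn.ofLine (f := fun t => (p.1, (1 - t) * p.2 + t * σ ⟨p.1, p, hp, rfl⟩))
      (by fun_prop) (by simp) (by simp) ?_
    rintro _ ⟨t, ht, rfl⟩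
    exact hconv p.1 hp (hσ ⟨p.1, p, hp, rfl⟩) (by linarith [ht.2]) ht.1 (by ring)
  have hsec (b c : Prod.fst '' E) : JoinedIn E (b.1, σ b) (c.1, σ c) := by
    have h := PathConnectedSpace.joined b c
    refine ⟨h.somePath.map (f := fun b => (b.1, σ b)) (by fun_prop), fun t => hσ _⟩
  obtain ⟨_, p, hp, rfl⟩ := hB.nonempty
  exact ⟨p, hp, fun {q} hq => (hfib p hp).trans ((hsec ⟨p.1, p, hp, rfl⟩ ⟨q.1, q, hq, rfl⟩).trans (hfib q hq).symm)⟩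

end ConvexFibres

noncomputable section

namespace TavisCummings

/-! ### The convex set of positive sextics -/

section Sextic

variable {R : Type*} [CommRing R]

/-- The normalized spectral polynomial, with `m = x² - d`. -/
def sextic (d s t k x : R) : R :=
  (x ^ 2 - d) ^ 3 + k * (x ^ 2 - d) ^ 2 + t * (x ^ 2 - d) + 1 + s * x * (x ^ 2 - d)

/-- The derivative of `sextic` in the variable `x`. -/
def sexticDeriv (d s t k x : R) : R :=
  6 * x * (x ^ 2 - d) ^ 2 + 4 * k * x * (x ^ 2 - d) + 2 * t * x + s * (3 * x ^ 2 - d)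

end Sextic

/-- The open convex set of the parameters of the everywhere positive sextics, in the coordinates
`((s, y), t)` with `y = k - t`. -/
def positiveSet (d : ℝ) : Set ((ℝ × ℝ) × ℝ) :=
  {p | ∀ x, 0 < sextic d p.1.1 p.2 (p.1.2 + p.2) x}

/-- The sextic with parameters `p` has a multiple complex root. -/
def HasDoubleRoot (d : ℝ) (p : (ℝ × ℝ) × ℝ) : Prop :=
  ∃ z : ℂ, sextic (d : ℂ) p.1.1 p.2 (p.1.2 + p.2) z = 0 ∧
    sexticDeriv (d : ℂ) p.1.1 p.2 (p.1.2 + p.2) z = 0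

/-- The bound is uniform in bounded coefficients; it leaves only a compact range of `x` in the proof
that `positiveSet` is open. -/
theorem sextic_pos_of_large {d s t k x M : ℝ} (hd : 0 < d) (hd1 : d ≤ 1 / 5) (hM : 0 ≤ M)
    (hs : |s| ≤ M) (ht : |t| ≤ M) (hk : |k| ≤ M) (hx : 2 * M + 3 ≤ x ^ 2) :
    0 < sextic d s t k x := by
  have hxx : |x| ≤ x ^ 2 := by
    rw [← sq_abs]
    rw [← sq_abs] at hx
    have : 1 ≤ |x| := by nlinarith [abs_nonneg x]
    nlinarith
  have hsx : |s * x| ≤ M * x ^ 2 := by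
    rw [abs_mul]
    gcongr
  obtain ⟨m, hm⟩ : ∃ m, x ^ 2 - d = m := ⟨_, rfl⟩
  have hx2 : x ^ 2 ≤ m + 1 := by linarith
  have hm2 : 2 * M + 2 ≤ m := by linarith
  have h1 : -(M * (m + 1)) ≤ s * x := by
    have := neg_le_of_abs_le hsx
    nlinarith
  have h2 := neg_le_of_abs_le ht
  have h3 := neg_le_of_abs_le hk
  unfold sextic
  rw [hm]
  have h4 : -M * m ^ 2 ≤ k * m ^ 2 := by gcongr
  have h5 : 0 ≤ m * (m ^ 2 - 2 * M * m - 2 * M) := by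
    apply mul_nonneg <;> nlinarith
  nlinarith

theorem isOpen_positiveSet {d : ℝ} (hd : 0 < d) (hd1 : d ≤ 1 / 5) : IsOpen (positiveSet d) := by
  rw [isOpen_iff_mem_nhds]
  intro p hp
  set M := |p.1.1| + |p.2| + |p.1.2 + p.2| + 1 with hM
  have hM0 : 0 ≤ M := by positivity
  have h1 : ∀ᶠ q : (ℝ × ℝ) × ℝ in nhds p, |q.1.1| < M :=
    (by fun_prop : Continuous fun q : (ℝ × ℝ) × ℝ => |q.1.1|).continuousAt.eventually_lt_const
      (by linarith [abs_nonneg p.2, abs_nonneg (p.1.2 + p.2)])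
  have h2 : ∀ᶠ q : (ℝ × ℝ) × ℝ in nhds p, |q.2| < M :=
    (by fun_prop : Continuous fun q : (ℝ × ℝ) × ℝ => |q.2|).continuousAt.eventually_lt_const
      (by linarith [abs_nonneg p.1.1, abs_nonneg (p.1.2 + p.2)])
  have h3 : ∀ᶠ q : (ℝ × ℝ) × ℝ in nhds p, |q.1.2 + q.2| < M :=
    (by fun_prop : Continuous fun q : (ℝ × ℝ) × ℝ => |q.1.2 + q.2|).continuousAt.eventually_lt_const
      (by linarith [abs_nonneg p.1.1, abs_nonneg p.2])
  have h4 : ∀ᶠ q : (ℝ × ℝ) × ℝ in nhds p, ∀ x ∈ Set.Icc (-(2 * M + 3)) (2 * M + 3),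
      0 < sextic d q.1.1 q.2 (q.1.2 + q.2) x := by
    refine isCompact_Icc.eventually_forall_of_forall_eventually fun x _ => ?_
    have : Continuous fun z : ((ℝ × ℝ) × ℝ) × ℝ =>
        sextic d z.1.1.1 z.1.2 (z.1.1.2 + z.1.2) z.2 := by
      unfold sextic
      fun_prop
    exact this.continuousAt.eventually_const_lt (hp x)
  filter_upwards [h1, h2, h3, h4] with q h1 h2 h3 h4 x
  by_cases hx : x ∈ Set.Icc (-(2 * M + 3)) (2 * M + 3)
  · exact h4 x hx
  · refine sextic_pos_of_large hd hd1 hM0 h1.le h2.le h3.le ?_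
    have : 2 * M + 3 ≤ |x| := by
      by_contra! h
      exact hx ⟨(abs_lt.1 h).1.le, (abs_lt.1 h).2.le⟩
    rw [← sq_abs]
    nlinarith

theorem convex_positiveSet (d : ℝ) : Convex ℝ (positiveSet d) := by
  intro p hp q hq a b ha hb hab x
  have e : sextic d (a • p + b • q).1.1 (a • p + b • q).2
      ((a • p + b • q).1.2 + (a • p + b • q).2) x
      = a * sextic d p.1.1 p.2 (p.1.2 + p.2) x + b * sextic d q.1.1 q.2 (q.1.2 + q.2) x := by
    obtain rfl : b = 1 - a := by linarith
    simp only [sextic, Prod.fst_add, Prod.snd_add, Prod.smul_fst, Prod.smul_snd, smul_eq_mul]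
    ring
  rw [e]
  rcases ha.eq_or_lt with rfl | ha
  · simpa [show b = 1 by linarith] using hq x
  · exact add_pos_of_pos_of_nonneg (mul_pos ha (hp x)) (mul_nonneg hb (hq x).le)

/-- For fixed `t`, the coordinate `y` is the coefficient of a square. This is what the choice `y = k
- t` gains. -/
theorem positiveSet_mono {d s y t y' : ℝ} (h : ((s, y), t) ∈ positiveSet d) (hy : y ≤ y') :
    ((s, y'), t) ∈ positiveSet d := by
  intro x
  have := h x
  have h2 : 0 ≤ (y' - y) * (x ^ 2 - d) ^ 2 := by
    have := sub_nonneg.2 hy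
    positivity
  simp only [sextic] at this ⊢
  nlinarith

theorem positiveSet_neg {d s y t : ℝ} (h : ((s, y), t) ∈ positiveSet d) :
    ((-s, y), t) ∈ positiveSet d := by
  intro x
  have := h (-x)
  simp only [sextic] at this ⊢
  nlinarith

theorem exists_mem_positiveSet (d s : ℝ) :
    ∃ y, ((s, y), (0 : ℝ)) ∈ positiveSet d := by
  obtain ⟨N, hN⟩ : ∃ N, N = d + s ^ 2 / 4 := ⟨_, rfl⟩
  -- With `m = x ^ 2 - d`, the summand `d` makes `m ^ 3 + d * m ^ 2` nonnegative, and the rest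
  -- dominates `s * x * m` by `h6`.
  refine ⟨d + 2 + N ^ 2 / 2, fun x => ?_⟩
  simp only [sextic]
  obtain ⟨m, hm⟩ : ∃ m, x ^ 2 - d = m := ⟨_, rfl⟩
  rw [hm]
  have h1 : -d ≤ m := by nlinarith
  have h2 : 0 ≤ (m + d) * m ^ 2 := mul_nonneg (by linarith) (sq_nonneg m)
  have h3 : |s * x| ≤ x ^ 2 + s ^ 2 / 4 := by
    rw [abs_le]
    constructor <;> nlinarith [sq_nonneg (x + s / 2), sq_nonneg (x - s / 2)]
  have h4 : |s * x * m| ≤ (|m| + N) * |m| := by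
    rw [abs_mul]
    gcongr
    have := le_abs_self m
    linarith
  have h5 := neg_le_of_abs_le h4
  have h6 : (|m| + N) * |m| ≤ m ^ 2 + 1 / 2 + N ^ 2 * m ^ 2 / 2 := by
    have e : |m| * |m| = m ^ 2 := by rw [abs_mul_abs_self]; ring
    nlinarith [sq_nonneg (N * |m| - 1)]
  nlinarith

/-! ### Factorizations with a squared quadratic -/

section Factor

variable {F : Type*} [Field F]

/-- For `s = 0` the sextic is a cubic in `m = z ^ 2 - d`. If `-S` is a double root, the constant
term 1 forces the third root to be `-1 / S ^ 2`. -/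
theorem sextic_eq_even (d S z : F) (hS : S ≠ 0) :
    sextic d 0 (S ^ 2 + 2 / S) (2 * S + 1 / S ^ 2) z
      = (z ^ 2 - d + S) ^ 2 * (z ^ 2 - d + 1 / S ^ 2) := by
  unfold sextic
  field_simp
  ring

theorem sexticDeriv_eq_even (d S z : F) (hS : S ≠ 0) :
    sexticDeriv d 0 (S ^ 2 + 2 / S) (2 * S + 1 / S ^ 2) z
      = (z ^ 2 - d + S) * (4 * z * (z ^ 2 - d + 1 / S ^ 2) + (z ^ 2 - d + S) * (2 * z)) := by
  unfold sexticDeriv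
  field_simp
  ring

/-- The difference of the two sides is a multiple of the constraint `hx`. -/
theorem sextic_eq_odd (d r x z : F) (hr : r ≠ 0) (hx : 4 * d * x ^ 2 = r ^ 4 - r) :
    sextic d (16 * x ^ 3 * (1 - d / r ^ 2))
      (2 * r ^ 4 + r - 12 * x ^ 2 * r ^ 2 + 4 * x ^ 2 * (r ^ 2 - 1 / r))
      (4 * r ^ 2 - 1 / r - 12 * x ^ 2) z
      = (z ^ 2 - d + r ^ 2 - 2 * x * z) ^ 2 * (z ^ 2 - d + (2 * r ^ 2 - 1 / r) + 4 * x * z) := by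
  rw [← sub_eq_zero]
  trans (2 * r ^ 2 + 1 / r - 4 * x * z + 3 * (z ^ 2 - d) - 4 * x * (z ^ 2 - d) * z / r ^ 2)
    * (4 * d * x ^ 2 - (r ^ 4 - r))
  · unfold sextic
    field_simp
    ring
  · rw [hx, sub_self, mul_zero]

theorem sexticDeriv_eq_odd (d r x z : F) (hr : r ≠ 0) (hx : 4 * d * x ^ 2 = r ^ 4 - r) :
    sexticDeriv d (16 * x ^ 3 * (1 - d / r ^ 2))
      (2 * r ^ 4 + r - 12 * x ^ 2 * r ^ 2 + 4 * x ^ 2 * (r ^ 2 - 1 / r))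
      (4 * r ^ 2 - 1 / r - 12 * x ^ 2) z
      = (z ^ 2 - d + r ^ 2 - 2 * x * z) *
        (2 * (2 * z - 2 * x) * (z ^ 2 - d + (2 * r ^ 2 - 1 / r) + 4 * x * z)
          + (z ^ 2 - d + r ^ 2 - 2 * x * z) * (2 * z + 4 * x)) := by
  rw [← sub_eq_zero]
  trans (-4 * x + 6 * z - 4 * x * (3 * z ^ 2 - d) / r ^ 2) * (4 * d * x ^ 2 - (r ^ 4 - r))
  · unfold sexticDeriv
    field_simp
    ring
  · rw [hx, sub_self, mul_zero]

end Factor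

/-! ### The curve of the even sextics with a double root -/

/-- The coordinate `t` on the curve of even sextics. -/
def evenT (S : ℝ) : ℝ := S ^ 2 + 2 / S

/-- The coordinate `y` on the curve of even sextics. -/
def evenY (S : ℝ) : ℝ := 2 * S + 1 / S ^ 2 - (S ^ 2 + 2 / S)

theorem evenY_exp_neg (u : ℝ) : evenY (Real.exp (-u)) = -evenY (Real.exp u) := by
  unfold evenY
  rw [Real.exp_neg]
  have := Real.exp_pos u
  field_simp
  ring

/-- After `S' - S` is factored out of the difference, positivity follows from the inequality between
the arithmetic mean and the geometric mean `a`. -/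
theorem evenY_lt_evenY {S S' : ℝ} (hS : 0 < S) (h : S < S') : evenY S' < evenY S := by
  have hS' : 0 < S' := hS.trans h
  obtain ⟨a, ha⟩ : ∃ a, a = √(S * S') := ⟨_, rfl⟩
  have ha2 : a ^ 2 = S * S' := by rw [ha, Real.sq_sqrt (by positivity)]
  have ha0 : 0 < a := by rw [ha]; positivity
  have hq : 2 * a < S + S' := by nlinarith [sq_nonneg (S - S'), mul_pos hS hS']
  have key : 0 < (S + S') * (a ^ 4 + 1) - 2 * a ^ 4 - 2 * a ^ 2 := by
    have h1 : 0 ≤ a * (a - 1) ^ 2 * (a ^ 2 + a + 1) := by positivity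
    have h2 : 2 * a * (a ^ 4 + 1) < (S + S') * (a ^ 4 + 1) := by gcongr
    nlinarith
  have e : evenY S - evenY S' =
      (S' - S) * ((S + S') * (a ^ 4 + 1) - 2 * a ^ 4 - 2 * a ^ 2) / (S ^ 2 * S' ^ 2) := by
    have h4 : a ^ 4 = (S * S') ^ 2 := by rw [← ha2]; ring
    unfold evenY
    rw [h4, ha2]
    field_simp
    ring
  have : 0 < evenY S - evenY S' := by
    rw [e]
    have := sub_pos.2 h
    positivity
  linarith

theorem continuous_evenY_exp : Continuous fun u => evenY (Real.exp u) := by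
  unfold evenY
  have h (u : ℝ) : Real.exp u ≠ 0 := (Real.exp_pos u).ne'
  have h2 (u : ℝ) : Real.exp u ^ 2 ≠ 0 := pow_ne_zero _ (h u)
  fun_prop (disch := assumption)

/-- Together with the symmetry `evenY_exp_neg`, this growth bound makes the parametrization
surjective. -/
theorem evenY_exp_le {u : ℝ} (hu : 0 ≤ u) : evenY (Real.exp u) ≤ 1 - u := by
  have h1 : 1 + u ≤ Real.exp u := by linarith [Real.add_one_le_exp u]
  generalize Real.exp u = S at h1
  have hS : 1 ≤ S := by linarith
  have hi : 1 / S ≤ 1 := by rw [div_le_one (by linarith)]; exact hS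
  have hi0 : 0 < 1 / S := by positivity
  have hi1 : 1 - 1 / S ≤ S - 1 := by
    have : S * (1 / S) = 1 := by field_simp
    nlinarith [sq_nonneg (S - 1)]
  have e : evenY S = (1 - 1 / S) ^ 2 - (S - 1) ^ 2 := by
    unfold evenY
    field_simp
    ring
  rw [e]
  rcases le_total u 1 with h | h
  · nlinarith
  · nlinarith

/-- The parametrization of the curve of even sextics by `y`. -/
def evenHomeomorph : ℝ ≃ₜ ℝ :=
  (StrictMono.orderIsoOfSurjective (fun u => evenY (Real.exp (-u)))
    (fun u v h => evenY_lt_evenY (Real.exp_pos _) (Real.exp_lt_exp.2 (neg_lt_neg h))) (by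
      refine Continuous.surjective (continuous_evenY_exp.comp continuous_neg) ?_ ?_
      · refine Filter.tendsto_atTop_mono' Filter.atTop (f₁ := fun u : ℝ => u - 1) ?_
          (Filter.tendsto_atTop_add_const_right _ _ Filter.tendsto_id)
        filter_upwards [Filter.eventually_ge_atTop 0] with u hu
        rw [evenY_exp_neg]
        linarith [evenY_exp_le hu]
      · refine Filter.tendsto_atBot_mono' Filter.atBot (f₁ := fun u : ℝ => u + 1) ?_
          (Filter.tendsto_atBot_add_const_right _ _ Filter.tendsto_id)
        filter_upwards [Filter.eventually_le_atBot 0] with u hu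
        linarith [evenY_exp_le (neg_nonneg.2 hu)])).toHomeomorph

/-- The parameter of the point of the curve of even sextics with given `y`. -/
def evenParam (y : ℝ) : ℝ := Real.exp (-evenHomeomorph.symm y)

theorem evenParam_pos (y : ℝ) : 0 < evenParam y := Real.exp_pos _

theorem continuous_evenParam : Continuous evenParam := by
  unfold evenParam
  fun_prop

theorem evenY_evenParam (y : ℝ) : evenY (evenParam y) = y := evenHomeomorph.apply_symm_apply y

theorem evenY_injOn {S S' : ℝ} (hS : 0 < S) (hS' : 0 < S') (h : evenY S = evenY S') : S = S' := by
  rcases lt_trichotomy S S' with h1 | h1 | h1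
  · exact absurd h (evenY_lt_evenY hS h1).ne'
  · exact h1
  · exact absurd h (evenY_lt_evenY hS' h1).ne

theorem evenParam_evenY {S : ℝ} (hS : 0 < S) : evenParam (evenY S) = S :=
  evenY_injOn (evenParam_pos _) hS (evenY_evenParam _)

theorem evenParam_lt {y y' : ℝ} (h : y < y') : evenParam y' < evenParam y := by
  by_contra! h1
  rcases h1.eq_or_lt with h1 | h1
  · have := congrArg evenY h1
    rw [evenY_evenParam, evenY_evenParam] at this
    exact h.ne this
  · have := evenY_lt_evenY (evenParam_pos _) h1
    rw [evenY_evenParam, evenY_evenParam] at this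
    exact lt_asymm h this

theorem evenParam_zero : evenParam 0 = 1 := by
  rw [← evenParam_evenY one_pos]
  norm_num [evenY]

/-- The coordinate `t` on the curve of even sextics, as a function of `y`. -/
def evenGraph (y : ℝ) : ℝ := evenT (evenParam y)

theorem continuous_evenGraph : Continuous evenGraph := by
  unfold evenGraph evenT
  have h (y : ℝ) : evenParam y ≠ 0 := (evenParam_pos y).ne'
  have := continuous_evenParam
  fun_prop (disch := assumption)

/-- The normalization constant: the points `± 1 / 2` of the spectral line become the zeros of
`x ^ 2 - delta`. -/
def delta : ℝ := (2 : ℝ) ^ (1 / 3 : ℝ) / 8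

theorem eight_mul_delta_pow : (8 * delta) ^ 3 = 2 := by
  unfold delta
  rw [mul_div_cancel₀ _ (by norm_num : (8 : ℝ) ≠ 0), ← Real.rpow_natCast, ← Real.rpow_mul two_pos.le]
  norm_num

theorem delta_pos : 0 < delta := by
  unfold delta
  positivity

theorem delta_le : delta ≤ 1 / 5 := by
  by_contra! h
  have h1 := eight_mul_delta_pow
  have : (8 * (1 / 5) : ℝ) ^ 3 < (8 * delta) ^ 3 := by gcongr
  norm_num at this h1
  linarith

/-! ### The curve of the sextics with a double root that are not even -/

/-- The square of the real part of the double root. -/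
def oddSq (r : ℝ) : ℝ := (r ^ 4 - r) / (4 * delta)

/-- The coordinate `s` on the curve of the sextics with a double root that are not even. -/
def oddS (r : ℝ) : ℝ := 16 * √(oddSq r) ^ 3 * (1 - delta / r ^ 2)

/-- The coordinate `t` on the curve of the sextics with a double root that are not even. -/
def oddT (r : ℝ) : ℝ := 2 * r ^ 4 + r - 12 * oddSq r * r ^ 2 + 4 * oddSq r * (r ^ 2 - 1 / r)

/-- The coordinate `y` on the curve of the sextics with a double root that are not even. -/
def oddY (r : ℝ) : ℝ := 4 * r ^ 2 - 1 / r - 12 * oddSq r - oddT r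

/-- The square of the imaginary part of the simple root. -/
def oddB (r : ℝ) : ℝ := 2 * r ^ 2 - 1 / r - delta - 4 * oddSq r

theorem oddSq_nonneg {r : ℝ} (hr : 1 ≤ r) : 0 ≤ oddSq r := by
  unfold oddSq
  have := delta_pos
  have : 0 ≤ r ^ 4 - r := by
    have : 1 ≤ r ^ 3 := one_le_pow₀ hr
    nlinarith
  positivity

/-- The factor `5 / 4` comes from `delta ≤ 1 / 5`. This growth rate makes `oddS` unbounded and
`oddB` decreasing. -/
theorem sub_le_oddSq {r r' : ℝ} (hr : 1 ≤ r) (h : r ≤ r') :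
    5 / 4 * ((r' - r) * (2 * (r + r') - 1)) ≤ oddSq r' - oddSq r := by
  have hd := delta_pos
  have hd' := delta_le
  have e : oddSq r' - oddSq r = (r' - r) * ((r + r') * (r ^ 2 + r' ^ 2) - 1) / (4 * delta) := by
    unfold oddSq
    ring
  have h0 : 0 ≤ r' - r := by linarith
  have h2 : 2 * (r + r') - 1 ≤ (r + r') * (r ^ 2 + r' ^ 2) - 1 := by
    have : 2 ≤ r ^ 2 + r' ^ 2 := by nlinarith
    nlinarith
  rw [e, le_div_iff₀ (by positivity)]
  have h3 : 0 ≤ (r' - r) * (2 * (r + r') - 1) := mul_nonneg h0 (by linarith)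
  calc 5 / 4 * ((r' - r) * (2 * (r + r') - 1)) * (4 * delta)
      = ((r' - r) * (2 * (r + r') - 1)) * (5 * delta) := by ring
    _ ≤ ((r' - r) * (2 * (r + r') - 1)) * 1 := by
        gcongr
        linarith
    _ ≤ _ := by
        rw [mul_one]
        gcongr

theorem oddSq_lt {r r' : ℝ} (hr : 1 ≤ r) (h : r < r') : oddSq r < oddSq r' := by
  have := sub_le_oddSq hr h.le
  have : 0 < (r' - r) * (2 * (r + r') - 1) := mul_pos (by linarith) (by linarith)
  linarith

theorem oddSq_one : oddSq 1 = 0 := by norm_num [oddSq]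

theorem oddS_one : oddS 1 = 0 := by norm_num [oddS, oddSq_one]

theorem oddY_one : oddY 1 = 0 := by norm_num [oddY, oddT, oddSq_one]

theorem oddT_one : oddT 1 = 3 := by norm_num [oddT, oddSq_one]

theorem delta_div_sq_le {r : ℝ} (hr : 1 ≤ r) : delta / r ^ 2 ≤ 1 / 5 := by
  have hd := delta_pos
  calc delta / r ^ 2 ≤ delta / 1 := by
        gcongr
        exact one_le_pow₀ hr
    _ ≤ 1 / 5 := by linarith [delta_le]

theorem oddS_lt {r r' : ℝ} (hr : 1 ≤ r) (h : r < r') : oddS r < oddS r' := by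
  have h0 := oddSq_nonneg hr
  have h1 := Real.sqrt_lt_sqrt h0 (oddSq_lt hr h)
  have hd := delta_pos
  have h2 : delta / r' ^ 2 ≤ delta / r ^ 2 := by gcongr
  have h3 := delta_div_sq_le hr
  unfold oddS
  have h4 : √(oddSq r) ^ 3 < √(oddSq r') ^ 3 := by gcongr
  have h5 : 0 ≤ √(oddSq r) ^ 3 := by positivity
  calc 16 * √(oddSq r) ^ 3 * (1 - delta / r ^ 2)
      ≤ 16 * √(oddSq r) ^ 3 * (1 - delta / r' ^ 2) := by gcongr
    _ < 16 * √(oddSq r') ^ 3 * (1 - delta / r' ^ 2) := by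
        have : 0 < 1 - delta / r' ^ 2 := by linarith
        gcongr

theorem sub_one_le_oddS {r : ℝ} (hr : 2 ≤ r) : r - 1 ≤ oddS r := by
  have h1 := sub_le_oddSq le_rfl (show 1 ≤ r by linarith)
  rw [oddSq_one] at h1
  have h2 : r - 1 ≤ oddSq r := by nlinarith
  have h3 : 1 ≤ √(oddSq r) := by
    rw [Real.one_le_sqrt]
    linarith
  have h4 : oddSq r ≤ √(oddSq r) ^ 3 := by
    calc oddSq r = √(oddSq r) ^ 2 := (Real.sq_sqrt (by linarith)).symm
      _ ≤ √(oddSq r) ^ 3 := pow_le_pow_right₀ h3 (by norm_num)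
  have h5 := delta_div_sq_le (show 1 ≤ r by linarith)
  unfold oddS
  nlinarith

theorem continuousOn_oddS : ContinuousOn oddS (Set.Ici 1) := by
  unfold oddS oddSq
  have h : ∀ r ∈ Set.Ici (1 : ℝ), r ^ 2 ≠ 0 := by
    intro r hr
    have : (1 : ℝ) ≤ r := hr
    positivity
  fun_prop (disch := assumption)

/-- A homeomorphism of the line that extends `oddS`. -/
def oddHomeomorph : ℝ ≃ₜ ℝ :=
  -- Only `r ≥ 1` matters; below 1 a line of slope one is attached to obtain a bijection of the
  -- whole line.
  (StrictMono.orderIsoOfSurjective (fun r => oddS (max r 1) + min (r - 1) 0)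
    (fun r r' h => by
      rcases lt_or_ge r 1 with h1 | h1
      · have hm : max r 1 = 1 := max_eq_right h1.le
        have hm' : min (r - 1) 0 = r - 1 := min_eq_left (by linarith)
        have h2 : oddS 1 ≤ oddS (max r' 1) := by
          rcases (le_max_right r' 1).eq_or_lt with h2 | h2
          · rw [← h2]
          · exact (oddS_lt le_rfl h2).le
        have h3 : r - 1 < min (r' - 1) 0 := lt_min (by linarith) (by linarith)
        simp only [hm, hm']
        linarith
      · have hm : max r 1 = r := max_eq_left h1
        have hm' : min (r - 1) 0 = 0 := min_eq_right (by linarith)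
        have hk : max r' 1 = r' := max_eq_left (by linarith)
        have hk' : min (r' - 1) 0 = 0 := min_eq_right (by linarith)
        simp only [hm, hm', hk, hk']
        linarith [oddS_lt h1 h]) (by
      refine Continuous.surjective ?_ ?_ ?_
      · refine Continuous.add ?_ (by fun_prop)
        exact continuousOn_oddS.comp_continuous (by fun_prop) fun r =>
          Set.mem_Ici.2 (le_max_right _ _)
      · refine Filter.tendsto_atTop_mono' Filter.atTop (f₁ := fun u : ℝ => u - 1) ?_
          (Filter.tendsto_atTop_add_const_right _ _ Filter.tendsto_id)
        filter_upwards [Filter.eventually_ge_atTop 2] with u hu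
        rw [max_eq_left (by linarith), min_eq_right (by linarith)]
        linarith [sub_one_le_oddS hu]
      · refine Filter.tendsto_atBot_mono' Filter.atBot (f₁ := fun u : ℝ => u - 1) ?_
          (Filter.tendsto_atBot_add_const_right _ _ Filter.tendsto_id)
        filter_upwards [Filter.eventually_le_atBot 0] with u hu
        rw [max_eq_right (by linarith), min_eq_left (by linarith), oddS_one]
        linarith)).toHomeomorph

theorem oddHomeomorph_of_one_le {r : ℝ} (hr : 1 ≤ r) : oddHomeomorph r = oddS r := by
  change oddS (max r 1) + min (r - 1) 0 = _
  rw [max_eq_left hr, min_eq_right (by linarith), add_zero]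

theorem oddHomeomorph_strictMono : StrictMono oddHomeomorph := OrderIso.strictMono _

/-- The parameter of the point of the curve with the given absolute value of `s`. -/
def oddParam (s : ℝ) : ℝ := oddHomeomorph.symm |s|

theorem continuous_oddParam : Continuous oddParam := by
  unfold oddParam
  fun_prop

theorem one_le_oddParam (s : ℝ) : 1 ≤ oddParam s := by
  rw [← oddHomeomorph_strictMono.le_iff_le]
  rw [oddHomeomorph_of_one_le le_rfl, oddS_one, oddParam, oddHomeomorph.apply_symm_apply]
  exact abs_nonneg s

theorem oddS_oddParam (s : ℝ) : oddS (oddParam s) = |s| := by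
  rw [← oddHomeomorph_of_one_le (one_le_oddParam s), oddParam, oddHomeomorph.apply_symm_apply]

theorem oddParam_eq {r s : ℝ} (hr : 1 ≤ r) (h : |s| = oddS r) : oddParam s = r := by
  rw [oddParam, h, ← oddHomeomorph_of_one_le hr, oddHomeomorph.symm_apply_apply]

theorem oddB_lt {r r' : ℝ} (hr : 1 ≤ r) (h : r < r') : oddB r' < oddB r := by
  have h1 := sub_le_oddSq hr h.le
  have h2 : 1 / r - 1 / r' ≤ r' - r := by
    have hr0 : r ≠ 0 := by linarith
    have hr0' : r' ≠ 0 := by linarith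
    have : 1 / r - 1 / r' = (r' - r) * (1 / (r * r')) := by
      field_simp
    rw [this]
    have h3 : 1 / (r * r') ≤ 1 := by
      rw [div_le_one (by nlinarith)]
      nlinarith
    nlinarith
  unfold oddB
  nlinarith

/-- At such an `r` the two simple roots merge on the real line, and the curve leaves the positive
set. -/
theorem exists_oddB_eq_zero : ∃ r, 1 < r ∧ oddB r = 0 := by
  have hc : ContinuousOn oddB (Set.Icc 1 2) := by
    unfold oddB oddSq
    have h : ∀ r ∈ Set.Icc (1 : ℝ) 2, r ≠ 0 := by
      intro r hr
      linarith [hr.1]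
    fun_prop (disch := assumption)
  have h1 : 0 < oddB 1 := by
    have := delta_le
    norm_num [oddB, oddSq_one]
    linarith
  have h2 : oddB 2 < 0 := by
    have h := sub_le_oddSq le_rfl (show (1 : ℝ) ≤ 2 by norm_num)
    have := delta_pos
    rw [oddSq_one] at h
    unfold oddB
    linarith
  obtain ⟨r, hr, h⟩ := intermediate_value_Icc' (by norm_num) hc ⟨h2.le, h1.le⟩
  refine ⟨r, hr.1.lt_of_ne ?_, h⟩
  rintro rfl
  exact h1.ne' h

/-- The parameter of the end of the curve. -/
def oddEnd : ℝ := exists_oddB_eq_zero.choose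

theorem one_lt_oddEnd : 1 < oddEnd := exists_oddB_eq_zero.choose_spec.1

theorem oddB_oddEnd : oddB oddEnd = 0 := exists_oddB_eq_zero.choose_spec.2

/-- The absolute value of `s` at the ends of the curve. -/
def oddBound : ℝ := oddS oddEnd

theorem oddBound_pos : 0 < oddBound := by
  rw [← oddS_one]
  exact oddS_lt le_rfl one_lt_oddEnd

theorem oddParam_lt_iff {s : ℝ} : oddParam s < oddEnd ↔ |s| < oddBound := by
  rw [← oddHomeomorph_strictMono.lt_iff_lt, oddHomeomorph_of_one_le (one_le_oddParam s),
    oddHomeomorph_of_one_le one_lt_oddEnd.le, oddS_oddParam, oddBound]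

theorem oddParam_of_abs_eq {s : ℝ} (h : |s| = oddBound) : oddParam s = oddEnd :=
  oddParam_eq one_lt_oddEnd.le h

theorem oddB_pos_iff {r : ℝ} (hr : 1 ≤ r) : 0 < oddB r ↔ r < oddEnd := by
  rw [← oddB_oddEnd]
  constructor
  · intro h
    by_contra! h1
    rcases h1.eq_or_lt with h1 | h1
    · exact h.ne (by rw [h1])
    · exact lt_asymm h (oddB_lt one_lt_oddEnd.le h1)
  · exact oddB_lt hr

/-- The coordinate `y` on the curve as a function of `s`, extended linearly beyond the ends. -/
def oddLine (s : ℝ) : ℝ :=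
  -- Beyond the ends the graph consists of two rays on lines through the origin. This makes the
  -- projection of the lower sheet star-shaped.
  if |s| ≤ oddBound then oddY (oddParam s) else oddY oddEnd / oddBound * |s|

/-- The coordinate `t` on the curve as a function of `s`. -/
def oddGraph (s : ℝ) : ℝ := oddT (oddParam s)

theorem oddLine_of_le {s : ℝ} (h : |s| ≤ oddBound) : oddLine s = oddY (oddParam s) := if_pos h

theorem oddLine_of_ge {s : ℝ} (h : oddBound ≤ |s|) :
    oddLine s = oddY oddEnd / oddBound * |s| := by
  rcases h.eq_or_lt with h | h
  · rw [oddLine_of_le h.ge, oddParam_of_abs_eq h.symm, ← h, div_mul_cancel₀ _ oddBound_pos.ne']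
  · exact if_neg h.not_ge

theorem continuous_oddT_oddParam : Continuous oddGraph := by
  unfold oddGraph oddT oddSq
  have h (s : ℝ) : oddParam s ≠ 0 := by linarith [one_le_oddParam s]
  have := continuous_oddParam
  fun_prop (disch := assumption)

theorem continuous_oddLine : Continuous oddLine := by
  have h1 : Continuous fun s => oddY (oddParam s) := by
    unfold oddY oddT oddSq
    have h (s : ℝ) : oddParam s ≠ 0 := by linarith [one_le_oddParam s]
    have := continuous_oddParam
    fun_prop (disch := assumption)
  refine Continuous.if_le h1 (by fun_prop) (by fun_prop) (by fun_prop) fun s hs => ?_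
  rw [← oddLine_of_le hs.le, oddLine_of_ge hs.ge]

theorem oddLine_zero : oddLine 0 = 0 := by
  rw [oddLine_of_le (by simpa using oddBound_pos.le), oddParam_eq le_rfl (by simp [oddS_one]),
    oddY_one]

theorem oddGraph_zero : oddGraph 0 = 3 := by
  rw [oddGraph, oddParam_eq le_rfl (by simp [oddS_one]), oddT_one]

theorem evenGraph_zero : evenGraph 0 = 3 := by
  rw [evenGraph, evenParam_zero]
  norm_num [evenT]

theorem oddLine_neg (s : ℝ) : oddLine (-s) = oddLine s := by
  simp only [oddLine, oddParam, abs_neg]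

/-- The sign of `m ^ 2 + m` at a real root, with `m = x ^ 2 - d`, decides on which side of a curve
the positive set lies once the curve has left it. -/
theorem sextic_shift (d s t t₀ y x : ℝ) :
    sextic d s t (y + t) x
      = sextic d s t₀ (y + t₀) x + (t - t₀) * ((x ^ 2 - d) ^ 2 + (x ^ 2 - d)) := by
  unfold sextic
  ring

theorem sextic_even {S : ℝ} (hS : 0 < S) (x : ℝ) :
    sextic delta 0 (evenT S) (evenY S + evenT S) x
      = (x ^ 2 - delta + S) ^ 2 * (x ^ 2 - delta + 1 / S ^ 2) := by
  rw [← sextic_eq_even _ _ _ hS.ne']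
  unfold evenY evenT
  congr 1
  ring

theorem even_mem_positiveSet {S : ℝ} (h1 : delta < S) (h2 : delta * S ^ 2 < 1) :
    (((0 : ℝ), evenY S), evenT S) ∈ positiveSet delta := by
  intro x
  have hS : 0 < S := delta_pos.trans h1
  have h3 : delta < 1 / S ^ 2 := by
    rw [lt_div_iff₀ (by positivity)]
    exact h2
  simp only [sextic_even hS]
  have h4 : 0 < x ^ 2 - delta + S := by nlinarith [sq_nonneg x]
  have h5 : 0 < x ^ 2 - delta + 1 / S ^ 2 := by nlinarith [sq_nonneg x]
  positivity

/-- The even sextic has a real root where `x ^ 2 - delta` lies in `[-delta, 0)`. There `m ^ 2 + m`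
is negative, so positivity needs a smaller `t`. -/
theorem lt_evenT_of_mem {S t : ℝ} (hS : 0 < S) (h : S ≤ delta ∨ 1 ≤ delta * S ^ 2)
    (ht : (((0 : ℝ), evenY S), t) ∈ positiveSet delta) : t < evenT S := by
  have hd := delta_pos
  have hd' := delta_le
  obtain ⟨m, hm0, hm1, hm⟩ : ∃ m, 0 < m ∧ m ≤ delta ∧ (-m + S) * (-m + 1 / S ^ 2) = 0 := by
    rcases h with h | h
    · exact ⟨S, hS, h, by simp⟩
    · refine ⟨1 / S ^ 2, by positivity, ?_, by simp⟩
      rw [div_le_iff₀ (by positivity)]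
      exact h
  have hx : √(delta - m) ^ 2 = delta - m := Real.sq_sqrt (by linarith)
  have h1 := ht √(delta - m)
  simp only at h1
  rw [sextic_shift _ _ _ (evenT S), sextic_even hS, hx] at h1
  have e : (delta - m - delta + S) ^ 2 * (delta - m - delta + 1 / S ^ 2) = 0 := by
    linear_combination (-m + S) * hm
  rw [e, zero_add] at h1
  by_contra! h2
  have : (delta - m - delta) ^ 2 + (delta - m - delta) ≤ 0 := by nlinarith
  nlinarith

theorem exists_odd_root {r s : ℝ} (hr : 1 ≤ r) (hs : |s| = oddS r) :
    ∃ x : ℝ, x ^ 2 = oddSq r ∧ 4 * delta * x ^ 2 = r ^ 4 - r ∧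
      s = 16 * x ^ 3 * (1 - delta / r ^ 2) := by
  have h0 := oddSq_nonneg hr
  have h1 : 4 * delta * oddSq r = r ^ 4 - r := by
    unfold oddSq
    have := delta_pos
    field_simp
  rcases abs_choice s with h | h
  · refine ⟨√(oddSq r), Real.sq_sqrt h0, by rw [Real.sq_sqrt h0, h1], ?_⟩
    rw [← h, hs, oddS]
  · refine ⟨-√(oddSq r), by rw [neg_sq, Real.sq_sqrt h0], by rw [neg_sq, Real.sq_sqrt h0, h1], ?_⟩
    have : s = -oddS r := by rw [← hs, h, neg_neg]
    rw [this, oddS]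
    ring

theorem sextic_odd {r s x : ℝ} (hr : 1 ≤ r) (h1 : x ^ 2 = oddSq r)
    (h2 : 4 * delta * x ^ 2 = r ^ 4 - r) (h3 : s = 16 * x ^ 3 * (1 - delta / r ^ 2)) (z : ℝ) :
    sextic delta s (oddT r) (oddY r + oddT r) z
      = (z ^ 2 - delta + r ^ 2 - 2 * x * z) ^ 2 * ((z + 2 * x) ^ 2 + oddB r) := by
  have e : (z + 2 * x) ^ 2 + oddB r = z ^ 2 - delta + (2 * r ^ 2 - 1 / r) + 4 * x * z := by
    unfold oddB
    rw [← h1]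
    ring
  rw [e, ← sextic_eq_odd _ _ _ _ (by positivity) h2, h3]
  unfold oddY oddT
  rw [← h1]
  congr 1
  ring

theorem odd_mem_positiveSet {r s : ℝ} (hr : 1 ≤ r) (hr' : r < oddEnd) (hs : |s| = oddS r) :
    ((s, oddY r), oddT r) ∈ positiveSet delta := by
  obtain ⟨x, h1, h2, h3⟩ := exists_odd_root hr hs
  intro z
  simp only [sextic_odd hr h1 h2 h3]
  have hB := (oddB_pos_iff hr).2 hr'
  have hd := delta_pos
  have hA : 0 < r ^ 2 - delta - x ^ 2 := by
    unfold oddB at hB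
    rw [← h1] at hB
    have h4 : 0 < 1 / r := by positivity
    have := delta_le
    nlinarith
  have h5 : 0 < z ^ 2 - delta + r ^ 2 - 2 * x * z := by nlinarith [sq_nonneg (z - x)]
  positivity

/-- Here the real root `-2 * x` has `m = 4 * x ^ 2 - delta > 0`, so in contrast with the even curve
positivity needs a larger `t`. -/
theorem oddT_lt_of_mem {s t : ℝ} (hs : |s| = oddBound)
    (ht : ((s, oddY oddEnd), t) ∈ positiveSet delta) : oddT oddEnd < t := by
  have hr := one_lt_oddEnd
  obtain ⟨x, h1, h2, h3⟩ := exists_odd_root hr.le hs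
  have h4 := ht (-(2 * x))
  simp only at h4
  rw [sextic_shift _ _ _ (oddT oddEnd), sextic_odd hr.le h1 h2 h3, oddB_oddEnd] at h4
  have h5 := oddB_oddEnd
  unfold oddB at h5
  rw [← h1] at h5
  have h6 : 1 / oddEnd ≤ 1 := by
    rw [div_le_one (by linarith)]
    exact hr.le
  have hd := delta_le
  have h7 : 0 < (-(2 * x)) ^ 2 - delta := by nlinarith
  by_contra! h8
  have : 0 ≤ (oddT oddEnd - t) * (((-(2 * x)) ^ 2 - delta) ^ 2 + ((-(2 * x)) ^ 2 - delta)) :=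
    mul_nonneg (by linarith) (by positivity)
  nlinarith

theorem hasDoubleRoot_even (y : ℝ) : HasDoubleRoot delta (((0 : ℝ), y), evenGraph y) := by
  have hS := evenParam_pos y
  have hy := evenY_evenParam y
  rw [evenGraph]
  generalize evenParam y = S at hS hy
  subst hy
  obtain ⟨z, hz⟩ := IsAlgClosed.exists_pow_nat_eq ((delta : ℂ) - S) (n := 2) (by norm_num)
  have hSC : (S : ℂ) ≠ 0 := by exact_mod_cast hS.ne'
  have e0 : z ^ 2 - (delta : ℂ) + S = 0 := by rw [hz]; ring
  have ek : ((evenY S : ℝ) : ℂ) + ((evenT S : ℝ) : ℂ) = 2 * (S : ℂ) + 1 / (S : ℂ) ^ 2 := by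
    unfold evenY evenT
    push_cast
    ring
  have et : ((evenT S : ℝ) : ℂ) = (S : ℂ) ^ 2 + 2 / S := by
    unfold evenT
    push_cast
    ring
  refine ⟨z, ?_, ?_⟩
  · simp only [ek]
    simp only [et, Complex.ofReal_zero]
    rw [sextic_eq_even _ _ _ hSC, e0]
    ring
  · simp only [ek]
    simp only [et, Complex.ofReal_zero]
    rw [sexticDeriv_eq_even _ _ _ hSC, e0]
    ring

theorem hasDoubleRoot_odd {s : ℝ} (hs : |s| ≤ oddBound) :
    HasDoubleRoot delta ((s, oddLine s), oddGraph s) := by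
  have hr := one_le_oddParam s
  have hsr := oddS_oddParam s
  rw [oddLine_of_le hs, oddGraph]
  generalize oddParam s = r at hr hsr
  obtain ⟨x, h1, h2, h3⟩ := exists_odd_root hr hsr.symm
  obtain ⟨w, hw⟩ := IsAlgClosed.exists_pow_nat_eq ((x : ℂ) ^ 2 + delta - r ^ 2) (n := 2)
    (by norm_num)
  have hrC : (r : ℂ) ≠ 0 := by exact_mod_cast (by linarith : r ≠ 0)
  have e0 : ((x : ℂ) + w) ^ 2 - (delta : ℂ) + r ^ 2 - 2 * x * (x + w) = 0 := by
    linear_combination hw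
  have h2C : 4 * (delta : ℂ) * (x : ℂ) ^ 2 = (r : ℂ) ^ 4 - r := by exact_mod_cast h2
  have es : (s : ℂ) = 16 * (x : ℂ) ^ 3 * (1 - delta / (r : ℂ) ^ 2) := by
    rw [h3]
    push_cast
    ring
  have ek : ((oddY r : ℝ) : ℂ) + ((oddT r : ℝ) : ℂ)
      = 4 * (r : ℂ) ^ 2 - 1 / r - 12 * (x : ℂ) ^ 2 := by
    unfold oddY oddT
    rw [← h1]
    push_cast
    ring
  have et : ((oddT r : ℝ) : ℂ) = 2 * (r : ℂ) ^ 4 + r - 12 * (x : ℂ) ^ 2 * (r : ℂ) ^ 2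
      + 4 * (x : ℂ) ^ 2 * ((r : ℂ) ^ 2 - 1 / r) := by
    unfold oddT
    rw [← h1]
    push_cast
    ring
  refine ⟨x + w, ?_, ?_⟩
  · simp only [ek]
    simp only [et, es]
    rw [sextic_eq_odd _ _ _ _ hrC h2C, e0]
    ring
  · simp only [ek]
    simp only [et, es]
    rw [sexticDeriv_eq_odd _ _ _ _ hrC h2C, e0]
    ring

/-! ### Classification of the sextics with a double root -/

open Polynomial in
/-- `sextic` as a polynomial. -/
def sexticPoly (d s t k : ℝ) : ℝ[X] :=
  (X ^ 2 - C d) ^ 3 + C k * (X ^ 2 - C d) ^ 2 + C t * (X ^ 2 - C d) + 1 + C s * X * (X ^ 2 - C d)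

open Polynomial

theorem eval_sexticPoly (d s t k x : ℝ) : (sexticPoly d s t k).eval x = sextic d s t k x := by
  simp [sexticPoly, sextic]

theorem aeval_sexticPoly (d s t k : ℝ) (z : ℂ) :
    aeval z (sexticPoly d s t k) = sextic (d : ℂ) s t k z := by
  simp [sexticPoly, sextic]

theorem aeval_derivative_sexticPoly (d s t k : ℝ) (z : ℂ) :
    aeval z (derivative (sexticPoly d s t k)) = sexticDeriv (d : ℂ) s t k z := by
  simp [sexticPoly, sexticDeriv, derivative_pow]
  ring

theorem natDegree_sexticPoly (d s t k : ℝ) : (sexticPoly d s t k).natDegree = 6 := by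
  unfold sexticPoly
  compute_degree!

theorem eq_zero_of_forall_eval {a b c d e f g : ℝ}
    (h : ∀ x : ℝ, a + b * x + c * x ^ 2 + d * x ^ 3 + e * x ^ 4 + f * x ^ 5 + g * x ^ 6 = 0) :
    a = 0 ∧ b = 0 ∧ c = 0 ∧ d = 0 ∧ e = 0 ∧ f = 0 ∧ g = 0 := by
  have h0 := h 0
  have h1 := h 1
  have h2 := h (-1)
  have h3 := h 2
  have h4 := h (-2)
  have h5 := h 3
  have h6 := h (-3)
  norm_num at h0 h1 h2 h3 h4 h5 h6
  refine ⟨?_, ?_, ?_, ?_, ?_, ?_, ?_⟩ <;> linarith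

/-- A sextic with a double root which is not real is the product of the square of a quadratic
polynomial and of a quadratic polynomial. -/
theorem exists_factor_of_double_root {d s t k : ℝ} {z : ℂ} (hz : z.im ≠ 0)
    (h0 : sextic (d : ℂ) s t k z = 0) (h1 : sexticDeriv (d : ℂ) s t k z = 0) :
    ∃ n e x : ℝ, x ^ 2 < n ∧ ∀ y, sextic d s t k y
      = (y ^ 2 - 2 * x * y + n) ^ 2 * (y ^ 2 + 4 * x * y + e) := by
  set q : ℝ[X] := X ^ 2 - C (2 * z.re) * X + C (‖z‖ ^ 2) with hq
  rw [← aeval_sexticPoly] at h0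
  rw [← aeval_derivative_sexticPoly] at h1
  obtain ⟨R, hR⟩ := quadratic_dvd_of_aeval_eq_zero_im_ne_zero _ h0 hz
  rw [← hq] at hR
  have hn : ‖z‖ ^ 2 = z.re ^ 2 + z.im ^ 2 := by
    rw [← Complex.normSq_eq_norm_sq, Complex.normSq_apply]
    ring
  have hqz : aeval z q = 0 := by
    rw [hq, hn]
    simp
    apply Complex.ext <;> simp [pow_two] <;> ring
  have hqz' : aeval z (derivative q) = 2 * z.im * Complex.I := by
    rw [hq, derivative_add, derivative_C, add_zero]
    simp
    apply Complex.ext <;> simp <;> first | ring1 | norm_num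
  have hRz : aeval z R = 0 := by
    rw [hR, derivative_mul, map_add, map_mul, map_mul, hqz, hqz', zero_mul, add_zero] at h1
    refine (mul_eq_zero.1 h1).resolve_left ?_
    simp [hz]
  obtain ⟨r, hr⟩ := quadratic_dvd_of_aeval_eq_zero_im_ne_zero _ hRz hz
  rw [← hq] at hr
  have hq2 : q.natDegree = 2 := by
    rw [hq]
    compute_degree!
  have hr2 : r.natDegree = 2 := by
    have h6 := natDegree_sexticPoly d s t k
    have hne : sexticPoly d s t k ≠ 0 := by
      intro h
      simp [h] at h6
    rw [hR, hr] at hne h6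
    have hq0 : q ≠ 0 := left_ne_zero_of_mul hne
    have hr0 : r ≠ 0 := right_ne_zero_of_mul (right_ne_zero_of_mul hne)
    rw [natDegree_mul hq0 (mul_ne_zero hq0 hr0), natDegree_mul hq0 hr0, hq2] at h6
    omega
  obtain ⟨α, c, e, hre⟩ : ∃ α c e : ℝ, ∀ y, r.eval y = α * y ^ 2 + c * y + e := by
    refine ⟨r.coeff 2, r.coeff 1, r.coeff 0, fun y => ?_⟩
    rw [eval_eq_sum_range, hr2]
    simp [Finset.sum_range_succ]
    ring
  have key (y : ℝ) : sextic d s t k y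
      = (y ^ 2 - 2 * z.re * y + ‖z‖ ^ 2) ^ 2 * (α * y ^ 2 + c * y + e) := by
    rw [← eval_sexticPoly, hR, hr, ← hre]
    simp [hq]
    ring
  refine ⟨‖z‖ ^ 2, e, z.re, ?_, ?_⟩
  · rw [hn]
    have : 0 < z.im ^ 2 := by positivity
    linarith
  generalize ‖z‖ ^ 2 = n at key
  generalize z.re = x at key
  have hcoef := eq_zero_of_forall_eval (a := -d ^ 3 + k * d ^ 2 - t * d + 1 - n ^ 2 * e)
    (b := -s * d - (-4 * x * n * e + n ^ 2 * c))
    (c := 3 * d ^ 2 - 2 * k * d + t - ((4 * x ^ 2 + 2 * n) * e - 4 * x * n * c + n ^ 2 * α))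
    (d := s - (-4 * x * e + (4 * x ^ 2 + 2 * n) * c - 4 * x * n * α))
    (e := -3 * d + k - (e - 4 * x * c + (4 * x ^ 2 + 2 * n) * α)) (f := -(c - 4 * x * α))
    (g := 1 - α) (fun y => by
      have := key y
      unfold sextic at this
      linear_combination this)
  obtain ⟨-, -, -, -, -, h5, h6⟩ := hcoef
  obtain rfl : α = 1 := by linarith
  obtain rfl : c = 4 * x := by linarith
  intro y
  rw [key]
  ring

/-- The coefficients of the product give an equation with factor `x`. Its two factors yield the two
curves. -/
theorem double_root_cases {d s t k x n e : ℝ} (hd : 0 < d) (hn : x ^ 2 < n)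
    (he : ∀ y, sextic d s t k y = (y ^ 2 - 2 * x * y + n) ^ 2 * (y ^ 2 + 4 * x * y + e)) :
    (∃ S, 0 < S ∧ s = 0 ∧ t = S ^ 2 + 2 / S ∧ k = 2 * S + 1 / S ^ 2) ∨
    (∃ r, 1 < r ∧ 4 * d * x ^ 2 = r ^ 4 - r ∧ s = 16 * x ^ 3 * (1 - d / r ^ 2) ∧
      t = 2 * r ^ 4 + r - 12 * x ^ 2 * r ^ 2 + 4 * x ^ 2 * (r ^ 2 - 1 / r) ∧
      k = 4 * r ^ 2 - 1 / r - 12 * x ^ 2 ∧ e = 2 * r ^ 2 - 1 / r - d) := by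
  have hcoef := eq_zero_of_forall_eval (a := -d ^ 3 + k * d ^ 2 - t * d + 1 - n ^ 2 * e)
    (b := -s * d - (-4 * x * n * e + n ^ 2 * (4 * x)))
    (c := 3 * d ^ 2 - 2 * k * d + t - ((4 * x ^ 2 + 2 * n) * e - 4 * x * n * (4 * x) + n ^ 2))
    (d := s - (-4 * x * e + (4 * x ^ 2 + 2 * n) * (4 * x) - 4 * x * n))
    (e := -3 * d + k - (e - 4 * x * (4 * x) + (4 * x ^ 2 + 2 * n))) (f := 0)
    (g := 0) (fun y => by
      have := he y
      unfold sextic at this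
      linear_combination this)
  obtain ⟨e0, e1, e2, e3, e4, -, -⟩ := hcoef
  obtain ⟨S, hS⟩ : ∃ S, S = n + d := ⟨_, rfl⟩
  obtain ⟨T, hT⟩ : ∃ T, T = e + d := ⟨_, rfl⟩
  obtain rfl : n = S - d := by linarith
  obtain rfl : e = T - d := by linarith
  have hS0 : 0 < S := by nlinarith [sq_nonneg x]
  have hk : k = 2 * S + T - 12 * x ^ 2 := by linarith
  subst hk
  have hs : s = 4 * x * (S - T + 4 * x ^ 2) := by linarith
  subst hs
  -- The sextic is 1 where `z ^ 2 = d`. Up to the factor `4 * z`, `h1` is the odd part in `z` of `(S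
  -- - 2 * x * z) ^ 2 * (T + 4 * x * z) = 1`, and `h2` is the even part.
  have h1 : x * (S * (S - T) + 4 * d * x ^ 2) = 0 := by linarith
  have h2 : T * (S ^ 2 + 4 * d * x ^ 2) - 16 * x ^ 2 * S * d = 1 := by nlinarith
  have ht : t = S ^ 2 + 4 * d * x ^ 2 + (2 * S + 4 * x ^ 2) * T - 16 * x ^ 2 * (S + d) := by
    linarith
  rcases mul_eq_zero.1 h1 with hx | hx
  · left
    subst hx
    have hT : T = 1 / S ^ 2 := by
      field_simp
      linarith
    refine ⟨S, hS0, by ring, ?_, ?_⟩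
    · rw [ht, hT]
      field_simp
      ring
    · rw [hT]
      ring
  · by_cases hx0 : x = 0
    · left
      subst hx0
      have hT : T = 1 / S ^ 2 := by
        field_simp
        linarith
      refine ⟨S, hS0, by ring, ?_, ?_⟩
      · rw [ht, hT]
        field_simp
        ring
      · rw [hT]
        ring
    · right
      obtain ⟨r, hr0, rfl⟩ : ∃ r, 0 < r ∧ r ^ 2 = S :=
        ⟨√S, Real.sqrt_pos.2 hS0, Real.sq_sqrt hS0.le⟩
      have h3 : (r ^ 4 - 4 * d * x ^ 2) ^ 2 = r ^ 2 := by
        have : T * r ^ 2 = r ^ 4 + 4 * d * x ^ 2 := by linarith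
        have h4 : (r ^ 4 + 4 * d * x ^ 2) * (r ^ 4 + 4 * d * x ^ 2) - 16 * x ^ 2 * r ^ 4 * d
            = r ^ 2 := by
          linear_combination r ^ 2 * h2 - (r ^ 4 + 4 * d * x ^ 2) * this
        linarith
      -- The root is not real, so `x ^ 2 + d < S`; with `4 * d * x ^ 2 ≤ (x ^ 2 + d) ^ 2` this
      -- selects the positive square root in `h3`.
      have h4 : 0 ≤ r ^ 4 - 4 * d * x ^ 2 := by
        have h5 : x ^ 2 + d ≤ r ^ 2 := by linarith
        have h6 : (x ^ 2 + d) ^ 2 ≤ (r ^ 2) ^ 2 := by gcongr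
        nlinarith [sq_nonneg (x ^ 2 - d)]
      have h5 : r ^ 4 - 4 * d * x ^ 2 = r := by
        rwa [sq_eq_sq₀ h4 hr0.le] at h3
      have hx2 : 0 < 4 * d * x ^ 2 := by positivity
      have hr1 : 1 < r := by
        by_contra! h
        have : r ^ 4 ≤ r := pow_le_of_le_one hr0.le h (by norm_num)
        linarith
      have hT : T = 2 * r ^ 2 - 1 / r := by
        field_simp
        have : r * (T * r - (2 * r ^ 3 - 1)) = 0 := by linear_combination -hx - h5
        have := (mul_eq_zero.1 this).resolve_left hr0.ne'
        linarith
      refine ⟨r, hr1, by linarith, ?_, ?_, ?_, by rw [hT]⟩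
      · rw [hT]
        field_simp
        linear_combination (-4) * h5
      · rw [ht, hT]
        field_simp
        linear_combination (3 * r) * h5
      · rw [hT]
        ring

/-- The points of the positive set whose sextic has a double root. -/
theorem hasDoubleRoot_cases {s y t : ℝ} (hp : ((s, y), t) ∈ positiveSet delta)
    (h : HasDoubleRoot delta ((s, y), t)) :
    (s = 0 ∧ t = evenGraph y) ∨ (|s| < oddBound ∧ y = oddLine s ∧ t = oddGraph s) := by
  obtain ⟨z, h0, h1⟩ := h
  simp only at h0 h1
  rw [← Complex.ofReal_add] at h0 h1
  have hz : z.im ≠ 0 := by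
    intro hz
    obtain ⟨x, rfl⟩ : ∃ x : ℝ, z = x := ⟨z.re, Complex.ext rfl (by simp [hz])⟩
    have := hp x
    have e : ((sextic delta s t (y + t) x : ℝ) : ℂ) = sextic (delta : ℂ) s t ↑(y + t) x := by
      unfold sextic
      push_cast
      ring
    rw [← e, Complex.ofReal_eq_zero] at h0
    exact this.ne' h0
  obtain ⟨n, e, x, hn, he⟩ := exists_factor_of_double_root hz h0 h1
  rcases double_root_cases delta_pos hn he with
    ⟨S, hS, rfl, ht, hk⟩ | ⟨r, hr, hx, hs, ht, hk, hB⟩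
  · left
    have hy : y = evenY S := by
      unfold evenY
      linarith
    refine ⟨rfl, ?_⟩
    rw [hy, evenGraph, evenParam_evenY hS, ht, evenT]
  · right
    have hd := delta_pos
    have hxS : x ^ 2 = oddSq r := by
      unfold oddSq
      field_simp
      linarith
    have hs' : |s| = oddS r := by
      have h1 : 0 < 1 - delta / r ^ 2 := by linarith [delta_div_sq_le hr.le]
      rw [hs, oddS, ← hxS, Real.sqrt_sq_eq_abs, abs_mul, abs_of_pos h1, abs_mul, abs_pow]
      norm_num
    have hpar : oddParam s = r := oddParam_eq hr.le hs'
    have hlt : |s| < oddBound := by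
      rw [← oddParam_lt_iff, hpar, ← oddB_pos_iff hr.le]
      have := hp (-2 * x)
      simp only [he] at this
      have h2 := (pos_iff_pos_of_mul_pos this).1 ((sq_nonneg _).lt_of_ne' (left_ne_zero_of_mul this.ne'))
      unfold oddB
      nlinarith
    have htr : t = oddT r := by
      unfold oddT
      rw [← hxS, ht]
    refine ⟨hlt, ?_, ?_⟩
    · rw [oddLine_of_le hlt.le, hpar]
      unfold oddY
      rw [← htr, ← hxS]
      linarith
    · rw [oddGraph, hpar, htr]

/-! ### The two sheets -/

/-- The parameters of the everywhere positive sextics without double root. -/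
def regularSet : Set ((ℝ × ℝ) × ℝ) := {p | p ∈ positiveSet delta ∧ ¬HasDoubleRoot delta p}

/-- The part of the regular set above the curves of the sextics with a double root. -/
def upperSheet : Set ((ℝ × ℝ) × ℝ) :=
  positiveSet delta ∩ ({p | p.1.1 = 0 ∧ p.2 ≤ evenGraph p.1.2}ᶜ ∩
    {p | |p.1.1| ≤ oddBound ∧ p.1.2 = oddLine p.1.1 ∧ p.2 ≤ oddGraph p.1.1}ᶜ)

/-- The part of the regular set below the curves of the sextics with a double root. -/
def lowerSheet : Set ((ℝ × ℝ) × ℝ) :=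
  positiveSet delta ∩ ({p | p.1.1 = 0 ∧ evenGraph p.1.2 ≤ p.2}ᶜ ∩
    {p | p.1.2 = oddLine p.1.1 ∧ (oddBound ≤ |p.1.1| ∨ oddGraph p.1.1 ≤ p.2)}ᶜ)

theorem positiveSet_isOpen : IsOpen (positiveSet delta) := isOpen_positiveSet delta_pos delta_le

theorem isOpen_upperSheet : IsOpen upperSheet := by
  have h1 := continuous_evenGraph
  have h2 := continuous_oddLine
  have h3 := continuous_oddT_oddParam
  refine positiveSet_isOpen.inter (IsOpen.inter ?_ ?_)
  · exact (IsClosed.and (isClosed_eq (by fun_prop) (by fun_prop))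
      (isClosed_le (by fun_prop) (by fun_prop))).isOpen_compl
  · exact (IsClosed.and (isClosed_le (by fun_prop) (by fun_prop))
      (IsClosed.and (isClosed_eq (by fun_prop) (by fun_prop))
        (isClosed_le (by fun_prop) (by fun_prop)))).isOpen_compl

theorem isOpen_lowerSheet : IsOpen lowerSheet := by
  have h1 := continuous_evenGraph
  have h2 := continuous_oddLine
  have h3 := continuous_oddT_oddParam
  refine positiveSet_isOpen.inter (IsOpen.inter ?_ ?_)
  · exact (IsClosed.and (isClosed_eq (by fun_prop) (by fun_prop))
      (isClosed_le (by fun_prop) (by fun_prop))).isOpen_compl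
  · exact (IsClosed.and (isClosed_eq (by fun_prop) (by fun_prop))
      (by
        rw [Set.ofPred_or]
        exact IsClosed.union (isClosed_le (by fun_prop) (by fun_prop))
          (isClosed_le (by fun_prop) (by fun_prop)))).isOpen_compl

theorem convex_fibre_positiveSet (q : ℝ × ℝ) : Convex ℝ {t | (q, t) ∈ positiveSet delta} := by
  intro t ht t' ht' a b ha hb hab
  have := convex_positiveSet delta ht ht' ha hb hab
  have e : a • ((q, t) : (ℝ × ℝ) × ℝ) + b • (q, t') = (q, a • t + b • t') := by
    refine Prod.ext ?_ rfl
    change a • q + b • q = q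
    rw [← add_smul, hab, one_smul]
  rwa [e] at this

/-- What is removed from a fibre of the positive set is closed downwards, so an interval remains. -/
theorem convex_fibre_upperSheet (q : ℝ × ℝ) : Convex ℝ {t | (q, t) ∈ upperSheet} := by
  refine Set.OrdConnected.convex ⟨?_⟩
  rintro t ⟨h1, h2, h3⟩ t' ⟨h1', -, -⟩ u hu
  refine ⟨(convex_fibre_positiveSet q).ordConnected.out h1 h1' hu, ?_, ?_⟩
  · exact fun h => h2 ⟨h.1, hu.1.trans h.2⟩
  · exact fun h => h3 ⟨h.1, h.2.1, hu.1.trans h.2.2⟩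

theorem convex_fibre_lowerSheet (q : ℝ × ℝ) : Convex ℝ {t | (q, t) ∈ lowerSheet} := by
  refine Set.OrdConnected.convex ⟨?_⟩
  rintro t ⟨h1, -, -⟩ t' ⟨h1', h2, h3⟩ u hu
  refine ⟨(convex_fibre_positiveSet q).ordConnected.out h1 h1' hu, ?_, ?_⟩
  · exact fun h => h2 ⟨h.1, h.2.trans hu.2⟩
  · exact fun h => h3 ⟨h.1, h.2.imp_right fun h => h.trans hu.2⟩

theorem exists_gt_mem_positiveSet {q : ℝ × ℝ} {t : ℝ} (h : (q, t) ∈ positiveSet delta) :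
    ∃ t', t < t' ∧ (q, t') ∈ positiveSet delta := by
  have hc : Continuous fun t' : ℝ => (q, t') := by fun_prop
  have h1 := hc.continuousAt.eventually (positiveSet_isOpen.mem_nhds h)
  obtain ⟨t', h2, h3⟩ := ((h1.filter_mono nhdsWithin_le_nhds).and
    (self_mem_nhdsWithin : Set.Ioi t ∈ nhdsWithin t (Set.Ioi t))).exists
  exact ⟨t', h3, h2⟩

theorem exists_lt_mem_positiveSet {q : ℝ × ℝ} {t : ℝ} (h : (q, t) ∈ positiveSet delta) :
    ∃ t', t' < t ∧ (q, t') ∈ positiveSet delta := by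
  have hc : Continuous fun t' : ℝ => (q, t') := by fun_prop
  have h1 := hc.continuousAt.eventually (positiveSet_isOpen.mem_nhds h)
  obtain ⟨t', h2, h3⟩ := ((h1.filter_mono nhdsWithin_le_nhds).and
    (self_mem_nhdsWithin : Set.Iio t ∈ nhdsWithin t (Set.Iio t))).exists
  exact ⟨t', h3, h2⟩

theorem exists_lt_mem_positiveSet' {s y t : ℝ} (h : ((s, y), t) ∈ positiveSet delta) :
    ∃ y', y' < y ∧ ((s, y'), t) ∈ positiveSet delta := by
  have hc : Continuous fun y' : ℝ => ((s, y'), t) := by fun_prop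
  have h1 := hc.continuousAt.eventually (positiveSet_isOpen.mem_nhds h)
  obtain ⟨t', h2, h3⟩ := ((h1.filter_mono nhdsWithin_le_nhds).and
    (self_mem_nhdsWithin : Set.Iio y ∈ nhdsWithin y (Set.Iio y))).exists
  exact ⟨t', h3, h2⟩

theorem evenGraph_mem {y : ℝ} (h1 : delta < evenParam y) (h2 : delta * evenParam y ^ 2 < 1) :
    (((0 : ℝ), y), evenGraph y) ∈ positiveSet delta := by
  have := even_mem_positiveSet h1 h2
  rwa [evenY_evenParam] at this

theorem lt_evenGraph {y t : ℝ} (h : evenParam y ≤ delta ∨ 1 ≤ delta * evenParam y ^ 2)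
    (ht : (((0 : ℝ), y), t) ∈ positiveSet delta) : t < evenGraph y := by
  refine lt_evenT_of_mem (evenParam_pos y) h ?_
  rwa [evenY_evenParam]

theorem oddGraph_mem {s : ℝ} (h : |s| < oddBound) :
    ((s, oddLine s), oddGraph s) ∈ positiveSet delta := by
  rw [oddLine_of_le h.le]
  exact odd_mem_positiveSet (one_le_oddParam s) (oddParam_lt_iff.2 h) (oddS_oddParam s).symm

theorem oddGraph_lt {s t : ℝ} (h : |s| = oddBound)
    (ht : ((s, oddLine s), t) ∈ positiveSet delta) : oddGraph s < t := by
  rw [oddGraph, oddParam_of_abs_eq h]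
  rw [oddLine_of_le h.le, oddParam_of_abs_eq h] at ht
  exact oddT_lt_of_mem h ht

theorem delta_lt_evenParam_zero : delta < evenParam 0 ∧ delta * evenParam 0 ^ 2 < 1 := by
  have := delta_le
  rw [evenParam_zero]
  constructor <;> linarith

theorem center_mem : (((0 : ℝ), (0 : ℝ)), (3 : ℝ)) ∈ positiveSet delta := by
  rw [← evenGraph_zero]
  exact evenGraph_mem delta_lt_evenParam_zero.1 delta_lt_evenParam_zero.2

/-- A fibre disappears only over the axis `s = 0` where the even curve has left the positive set,
for there it lies below the curve. Elsewhere openness leaves room above the curves. -/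
theorem mem_image_upperSheet {s y : ℝ} : (s, y) ∈ Prod.fst '' upperSheet ↔
    (∃ t, ((s, y), t) ∈ positiveSet delta) ∧
      (s = 0 → delta < evenParam y ∧ delta * evenParam y ^ 2 < 1) := by
  constructor
  · rintro ⟨⟨q, t⟩, ⟨h1, h2, h3⟩, rfl⟩
    refine ⟨⟨t, h1⟩, ?_⟩
    rintro rfl
    by_contra h4
    refine h2 ⟨rfl, (lt_evenGraph ?_ h1).le⟩
    by_contra! h5
    exact h4 h5
  · rintro ⟨⟨t, ht⟩, h⟩
    by_cases hs : s = 0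
    · subst hs
      obtain ⟨t', h1, h2⟩ := exists_gt_mem_positiveSet (evenGraph_mem (h rfl).1 (h rfl).2)
      refine ⟨((0, y), t'), ⟨h2, fun h3 => h1.not_ge h3.2, ?_⟩, rfl⟩
      rintro ⟨-, h3, h4⟩
      simp only [oddLine_zero, oddGraph_zero] at h3 h4
      rw [h3, evenGraph_zero] at h1
      exact h1.not_ge h4
    · by_cases h1 : |s| ≤ oddBound ∧ y = oddLine s
      · obtain ⟨h1, rfl⟩ := h1
        rcases h1.lt_or_eq with h1 | h1
        · obtain ⟨t', h2, h3⟩ := exists_gt_mem_positiveSet (oddGraph_mem h1)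
          exact ⟨((s, _), t'), ⟨h3, fun h4 => hs h4.1, fun h4 => h2.not_ge h4.2.2⟩, rfl⟩
        · exact ⟨((s, _), t), ⟨ht, fun h4 => hs h4.1,
            fun h4 => (oddGraph_lt h1 ht).not_ge h4.2.2⟩, rfl⟩
      · exact ⟨((s, y), t), ⟨ht, fun h4 => hs h4.1, fun h4 => h1 ⟨h4.1, h4.2.1⟩⟩, rfl⟩

/-- Here the two radial ends of `oddLine` are lost, while the fibres over the ends of the even curve
survive. -/
theorem mem_image_lowerSheet {s y : ℝ} : (s, y) ∈ Prod.fst '' lowerSheet ↔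
    (∃ t, ((s, y), t) ∈ positiveSet delta) ∧ (y = oddLine s → |s| < oddBound) := by
  constructor
  · rintro ⟨⟨q, t⟩, ⟨h1, h2, h3⟩, rfl⟩
    refine ⟨⟨t, h1⟩, fun h4 => ?_⟩
    by_contra! h5
    exact h3 ⟨h4, .inl h5⟩
  · rintro ⟨⟨t, ht⟩, h⟩
    by_cases hs : s = 0
    · subst hs
      by_cases hy : delta < evenParam y ∧ delta * evenParam y ^ 2 < 1
      · obtain ⟨t', h1, h2⟩ := exists_lt_mem_positiveSet (evenGraph_mem hy.1 hy.2)
        refine ⟨((0, y), t'), ⟨h2, fun h3 => h1.not_ge h3.2, ?_⟩, rfl⟩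
        rintro ⟨h3, h4⟩
        simp only [oddLine_zero, oddGraph_zero] at h3 h4
        rw [h3, evenGraph_zero] at h1
        rcases h4 with h4 | h4
        · simp only [abs_zero] at h4
          exact h4.not_gt oddBound_pos
        · exact h1.not_ge h4
      · refine ⟨((0, y), t), ⟨ht, fun h3 => (lt_evenGraph ?_ ht).not_ge h3.2, ?_⟩, rfl⟩
        · by_contra! h5
          exact hy h5
        · rintro ⟨h3, -⟩
          simp only [oddLine_zero] at h3
          exact hy (h3 ▸ delta_lt_evenParam_zero)
    · by_cases h1 : y = oddLine s
      · obtain ⟨t', h2, h3⟩ := exists_lt_mem_positiveSet (oddGraph_mem (h h1))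
        subst h1
        exact ⟨((s, _), t'), ⟨h3, fun h4 => hs h4.1, fun h4 => h4.2.elim
          (fun h5 => (h rfl).not_ge h5) fun h5 => h2.not_ge h5⟩, rfl⟩
      · exact ⟨((s, y), t), ⟨ht, fun h4 => hs h4.1, fun h4 => h1 h4.1⟩, rfl⟩

theorem smul_mem_image_positiveSet {s y a : ℝ} (h : ∃ t, ((s, y), t) ∈ positiveSet delta)
    (h0 : 0 ≤ a) (h1 : a ≤ 1) : ∃ t, ((a * s, a * y), t) ∈ positiveSet delta := by
  obtain ⟨t, ht⟩ := h
  have := convex_positiveSet delta center_mem ht (sub_nonneg.2 h1) h0 (by ring)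
  refine ⟨(1 - a) * 3 + a * t, ?_⟩
  simpa using this

/-- The projection is star-shaped about the origin: it is a convex set without two ends of the
`y`-axis, since `evenParam` is monotone. -/
theorem isSimplyConnected_upperSheet : IsSimplyConnected upperSheet := by
  refine isOpen_upperSheet.isSimplyConnected_of_convex_fibres convex_fibre_upperSheet ?_
  have h0 : ((0 : ℝ), (0 : ℝ)) ∈ Prod.fst '' upperSheet :=
    mem_image_upperSheet.2 ⟨⟨3, center_mem⟩, fun _ => delta_lt_evenParam_zero⟩
  refine StarConvex.contractibleSpace (x := ((0 : ℝ), (0 : ℝ))) ?_ ⟨_, h0⟩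
  rintro ⟨s, y⟩ h a b ha hb hab
  have e : a • ((0 : ℝ), (0 : ℝ)) + b • (s, y) = (b * s, b * y) := by simp
  rw [e, mem_image_upperSheet]
  rw [mem_image_upperSheet] at h
  refine ⟨smul_mem_image_positiveSet h.1 hb (by linarith), fun h1 => ?_⟩
  have hz := delta_lt_evenParam_zero
  rcases mul_eq_zero.1 h1 with rfl | rfl
  · rwa [zero_mul]
  obtain ⟨h2, h3⟩ := h.2 rfl
  have hmono {y y' : ℝ} (h : y ≤ y') : evenParam y' ≤ evenParam y := by
    rcases h.eq_or_lt with rfl | h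
    exacts [le_rfl, (evenParam_lt h).le]
  have hd := delta_pos
  have hpos := evenParam_pos (b * y)
  rcases le_total 0 y with hy | hy
  · have h4 : evenParam y ≤ evenParam (b * y) := hmono (by nlinarith)
    have h5 : evenParam (b * y) ≤ evenParam 0 := hmono (by positivity)
    exact ⟨h2.trans_le h4, lt_of_le_of_lt (by gcongr) hz.2⟩
  · have h4 : evenParam (b * y) ≤ evenParam y := hmono (by nlinarith)
    have h5 : evenParam 0 ≤ evenParam (b * y) := hmono (mul_nonpos_of_nonneg_of_nonpos hb hy)
    exact ⟨hz.1.trans_le h5, lt_of_le_of_lt (by gcongr) h3⟩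

/-- The curves removed from the projection are radial, so a segment from the origin that meets one
of them has its endpoint on it. -/
theorem isSimplyConnected_lowerSheet : IsSimplyConnected lowerSheet := by
  refine isOpen_lowerSheet.isSimplyConnected_of_convex_fibres convex_fibre_lowerSheet ?_
  have h0 : ((0 : ℝ), (0 : ℝ)) ∈ Prod.fst '' lowerSheet :=
    mem_image_lowerSheet.2 ⟨⟨3, center_mem⟩, fun _ => by simpa using oddBound_pos⟩
  refine StarConvex.contractibleSpace (x := ((0 : ℝ), (0 : ℝ))) ?_ ⟨_, h0⟩
  rintro ⟨s, y⟩ h a b ha hb hab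
  have e : a • ((0 : ℝ), (0 : ℝ)) + b • (s, y) = (b * s, b * y) := by simp
  rw [e, mem_image_lowerSheet]
  rw [mem_image_lowerSheet] at h
  refine ⟨smul_mem_image_positiveSet h.1 hb (by linarith), fun h1 => ?_⟩
  by_contra! h2
  have hb0 : b ≠ 0 := by
    rintro rfl
    simp only [zero_mul, abs_zero] at h2
    exact h2.not_gt oddBound_pos
  have h3 : |b * s| = b * |s| := by rw [abs_mul, abs_of_nonneg hb]
  have h4 : oddBound ≤ |s| := by
    rw [h3] at h2
    nlinarith [abs_nonneg s]
  rw [oddLine_of_ge h2, h3] at h1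
  have h5 : y = oddLine s := by
    rw [oddLine_of_ge h4]
    apply mul_left_cancel₀ hb0
    rw [h1]
    ring
  exact (h.2 h5).not_ge h4

/-! ### The four components of the intersection -/

/-- The four parts of the complement of the vertical planes over the two curves. -/
def quadrant (b c : Bool) : Set ((ℝ × ℝ) × ℝ) :=
  {p | p ∈ positiveSet delta ∧ (if b then 0 < p.1.1 else p.1.1 < 0) ∧
    if c then oddLine p.1.1 < p.1.2 else p.1.2 < oddLine p.1.1}

theorem isOpen_quadrant (b c : Bool) : IsOpen (quadrant b c) := by
  have h2 := continuous_oddLine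
  refine positiveSet_isOpen.inter (IsOpen.inter ?_ ?_)
  · cases b
    · exact isOpen_lt (by fun_prop) (by fun_prop)
    · exact isOpen_lt (by fun_prop) (by fun_prop)
  · cases c
    · exact isOpen_lt (by fun_prop) (by fun_prop)
    · exact isOpen_lt (by fun_prop) (by fun_prop)

theorem convex_fibre_quadrant (b c : Bool) (q : ℝ × ℝ) :
    Convex ℝ {t | (q, t) ∈ quadrant b c} := by
  by_cases h : (if b then 0 < q.1 else q.1 < 0) ∧ if c then oddLine q.1 < q.2 else q.2 < oddLine q.1
  · simpa [quadrant, h.1, h.2] using convex_fibre_positiveSet q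
  · have e : {t | (q, t) ∈ quadrant b c} = ∅ := by
      ext t
      simp only [Set.mem_ofPred_eq, Set.mem_empty_iff_false, iff_false]
      exact fun h' => h h'.2
    rw [e]
    exact convex_empty

/-- A second projection, to `s`: the fibres are closed upwards by `positiveSet_mono`, and every `s >
0` occurs. -/
theorem isPathConnected_image_upper :
    IsPathConnected (Prod.fst '' quadrant true true) := by
  refine (isOpenMap_fst _ (isOpen_quadrant _ _)).isPathConnected_of_convex_fibres ?_ ?_
  · intro s
    refine Set.OrdConnected.convex ⟨?_⟩
    rintro _ ⟨⟨⟨_, y⟩, t⟩, ⟨h1, h2, h3⟩, rfl, rfl⟩ z - w hw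
    exact ⟨((_, w), t), ⟨positiveSet_mono h1 hw.1, h2, h3.trans_le hw.1⟩, rfl⟩
  · have e : Prod.fst '' (Prod.fst '' quadrant true true) = Set.Ioi 0 := by
      ext s
      constructor
      · rintro ⟨_, ⟨⟨⟨s, y⟩, t⟩, ⟨h1, h2, h3⟩, rfl⟩, rfl⟩
        exact h2
      · intro hs
        obtain ⟨y, hy⟩ := exists_mem_positiveSet delta s
        refine ⟨(s, max y (oddLine s + 1)), ⟨((s, max y (oddLine s + 1)), 0),
          ⟨positiveSet_mono hy (le_max_left _ _), hs, ?_⟩, rfl⟩, rfl⟩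
        exact lt_of_lt_of_le (by simp) (le_max_right _ _)
    rw [e]
    exact (convex_Ioi 0).isPathConnected ⟨1, by simp⟩

/-- Up to `oddBound` the curve itself is positive. Beyond it the point is moved along its ray
towards the centre, by convexity. -/
theorem oddLine_mem_of_le {s s' : ℝ} (h : ∃ t, ((s, oddLine s), t) ∈ positiveSet delta)
    (h0 : 0 < s') (hs : s' ≤ s) : ∃ t, ((s', oddLine s'), t) ∈ positiveSet delta := by
  rcases lt_or_ge |s'| oddBound with h1 | h1
  · exact ⟨_, oddGraph_mem h1⟩
  · have hs0 : 0 < s := h0.trans_le hs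
    have h2 : oddBound ≤ |s| := by
      rw [abs_of_pos h0] at h1
      rw [abs_of_pos hs0]
      linarith
    have := smul_mem_image_positiveSet (a := s' / s) h (by positivity)
      (by rw [div_le_one hs0]; exact hs)
    rw [div_mul_cancel₀ _ hs0.ne', oddLine_of_ge h2] at this
    rw [oddLine_of_ge h1]
    convert this using 5
    rw [abs_of_pos h0, abs_of_pos hs0]
    field_simp

theorem isPathConnected_image_lower :
    IsPathConnected (Prod.fst '' quadrant true false) := by
  refine (isOpenMap_fst _ (isOpen_quadrant _ _)).isPathConnected_of_convex_fibres ?_ ?_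
  · intro s
    refine Set.OrdConnected.convex ⟨?_⟩
    rintro _ ⟨⟨⟨_, y⟩, t⟩, ⟨h1, h2, h3⟩, rfl, rfl⟩ z ⟨⟨⟨_, z'⟩, t'⟩, ⟨h1', h2', h3'⟩, e⟩ w hw
    obtain ⟨rfl, rfl⟩ := Prod.mk.inj e
    exact ⟨((_, w), t), ⟨positiveSet_mono h1 hw.1, h2, hw.2.trans_lt h3'⟩, rfl⟩
  · have e : Prod.fst '' (Prod.fst '' quadrant true false)
        = {s | 0 < s ∧ ∃ t, ((s, oddLine s), t) ∈ positiveSet delta} := by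
      ext s
      constructor
      · rintro ⟨_, ⟨⟨⟨s, y⟩, t⟩, ⟨h1, h2, h3⟩, rfl⟩, rfl⟩
        exact ⟨h2, t, positiveSet_mono h1 h3.le⟩
      · rintro ⟨hs, t, ht⟩
        obtain ⟨y, hy, h⟩ := exists_lt_mem_positiveSet' ht
        exact ⟨(s, y), ⟨((s, y), t), ⟨h, hs, hy⟩, rfl⟩, rfl⟩
    rw [e]
    refine Convex.isPathConnected (Set.OrdConnected.convex ⟨?_⟩) ?_
    · rintro s ⟨hs, -⟩ s' ⟨hs', h⟩ u hu
      exact ⟨hs.trans_le hu.1, oddLine_mem_of_le h (hs.trans_le hu.1) hu.2⟩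
    · have h := oddBound_pos
      refine ⟨oddBound / 2, by positivity, _, oddGraph_mem ?_⟩
      rw [abs_of_pos (by positivity)]
      linarith

theorem isPathConnected_quadrant (b c : Bool) : IsPathConnected (quadrant b c) := by
  have h (c : Bool) : IsPathConnected (quadrant true c) := by
    refine (isOpen_quadrant _ _).isPathConnected_of_convex_fibres (convex_fibre_quadrant _ _) ?_
    cases c
    exacts [isPathConnected_image_lower, isPathConnected_image_upper]
  cases b
  · have e : quadrant false c = (fun p : (ℝ × ℝ) × ℝ => ((-p.1.1, p.1.2), p.2)) '' quadrant true c := by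
      ext ⟨⟨s, y⟩, t⟩
      constructor
      · rintro ⟨h1, h2, h3⟩
        refine ⟨((-s, y), t), ⟨positiveSet_neg h1, ?_, ?_⟩, by simp⟩
        · simpa using h2
        · simpa [oddLine_neg] using h3
      · rintro ⟨⟨⟨s', y'⟩, t'⟩, ⟨h1, h2, h3⟩, e⟩
        simp only [Prod.mk.injEq] at e
        obtain ⟨⟨rfl, rfl⟩, rfl⟩ := e
        refine ⟨positiveSet_neg h1, ?_, ?_⟩
        · simpa using h2
        · simpa [oddLine_neg] using h3
    rw [e]
    exact (h c).image (by fun_prop)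
  · exact h c

/-- Over `s = 0` and over `y = oddLine s` no point lies in both sheets; elsewhere nothing is removed
from either. -/
theorem mem_upperSheet_and_mem_lowerSheet {p : (ℝ × ℝ) × ℝ} :
    (p ∈ upperSheet ∧ p ∈ lowerSheet) ↔ ∃ b c, p ∈ quadrant b c := by
  constructor
  · rintro ⟨⟨h1, h2, h3⟩, -, h4, h5⟩
    have hs : p.1.1 ≠ 0 := by
      intro h
      rcases le_total p.2 (evenGraph p.1.2) with h6 | h6
      exacts [h2 ⟨h, h6⟩, h4 ⟨h, h6⟩]
    have hy : p.1.2 ≠ oddLine p.1.1 := by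
      intro h
      rcases le_total |p.1.1| oddBound with h6 | h6
      · rcases le_total p.2 (oddGraph p.1.1) with h7 | h7
        exacts [h3 ⟨h6, h, h7⟩, h5 ⟨h, .inr h7⟩]
      · exact h5 ⟨h, .inl h6⟩
    refine ⟨decide (0 < p.1.1), decide (oddLine p.1.1 < p.1.2), h1, ?_, ?_⟩
    · rcases hs.lt_or_gt with h | h
      · simp [h, h.not_gt]
      · simp [h]
    · rcases hy.lt_or_gt with h | h
      · simp [h, h.not_gt]
      · simp [h]
  · rintro ⟨b, c, h1, h2, h3⟩
    have hs : p.1.1 ≠ 0 := by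
      cases b
      · exact LT.lt.ne (by simpa using h2)
      · exact LT.lt.ne' (by simpa using h2)
    have hy : p.1.2 ≠ oddLine p.1.1 := by
      cases c
      · exact LT.lt.ne (by simpa using h3)
      · exact LT.lt.ne' (by simpa using h3)
    exact ⟨⟨h1, fun h => hs h.1, fun h => hy h.2.1⟩, h1, fun h => hs h.1, fun h => hy h.1⟩

theorem quadrant_injective {b c b' c' : Bool} {p : (ℝ × ℝ) × ℝ} (h : p ∈ quadrant b c)
    (h' : p ∈ quadrant b' c') : (b, c) = (b', c') := by
  obtain ⟨-, h1, h2⟩ := h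
  obtain ⟨-, h1', h2'⟩ := h'
  refine Prod.ext ?_ ?_
  · cases b <;> cases b' <;> simp at h1 h1' ⊢ <;> linarith
  · cases c <;> cases c' <;> simp at h2 h2' ⊢ <;> linarith

/-- Off the curves a point over one of them is above or below it. Over the radial ends of `oddLine`
the upper sheet takes the whole fibre, over the ends of the even curve the lower one does. -/
theorem regularSet_eq : regularSet = upperSheet ∪ lowerSheet := by
  ext ⟨⟨s, y⟩, t⟩
  constructor
  · rintro ⟨h1, h2⟩
    by_cases hs : s = 0
    · subst hs
      rcases lt_trichotomy t (evenGraph y) with h | h | h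
      · right
        refine ⟨h1, fun h3 => h.not_ge h3.2, ?_⟩
        rintro ⟨h3, h4⟩
        simp only [oddLine_zero, oddGraph_zero, abs_zero] at h3 h4
        rw [h3, evenGraph_zero] at h
        exact h4.elim oddBound_pos.not_ge h.not_ge
      · exact (h2 (h ▸ hasDoubleRoot_even y)).elim
      · left
        refine ⟨h1, fun h3 => h.not_ge h3.2, ?_⟩
        rintro ⟨-, h3, h4⟩
        simp only [oddLine_zero, oddGraph_zero] at h3 h4
        rw [h3, evenGraph_zero] at h
        exact h.not_ge h4
    · by_cases hy : |s| ≤ oddBound ∧ y = oddLine s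
      · obtain ⟨h3, rfl⟩ := hy
        rcases lt_trichotomy t (oddGraph s) with h | h | h
        · right
          refine ⟨h1, fun h3 => hs h3.1, ?_⟩
          rintro ⟨-, h4 | h4⟩
          · exact lt_asymm h (oddGraph_lt (le_antisymm h3 h4) h1)
          · exact h.not_ge h4
        · exact (h2 (h ▸ hasDoubleRoot_odd h3)).elim
        · left
          exact ⟨h1, fun h3 => hs h3.1, fun h4 => h.not_ge h4.2.2⟩
      · left
        exact ⟨h1, fun h3 => hs h3.1, fun h4 => hy ⟨h4.1, h4.2.1⟩⟩
  · rintro (⟨h1, h2, h3⟩ | ⟨h1, h2, h3⟩)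
    · refine ⟨h1, fun h => ?_⟩
      rcases hasDoubleRoot_cases h1 h with ⟨h4, h5⟩ | ⟨h4, h5, h6⟩
      exacts [h2 ⟨h4, h5.le⟩, h3 ⟨h4.le, h5, h6.le⟩]
    · refine ⟨h1, fun h => ?_⟩
      rcases hasDoubleRoot_cases h1 h with ⟨h4, h5⟩ | ⟨h4, h5, h6⟩
      exacts [h2 ⟨h4, h5.ge⟩, h3 ⟨h5, .inr h6.ge⟩]

/-! ### Transport of the cover along an embedding -/

open Topology

theorem isSimplyConnected_preimage_of_subset_range {X Y : Type*} [TopologicalSpace X]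
    [TopologicalSpace Y] {f : X → Y} (hf : IsEmbedding f) {V : Set Y} (hV : IsSimplyConnected V)
    (h : V ⊆ Set.range f) : IsSimplyConnected (f ⁻¹' V) := by
  rw [← hf.isSimplyConnected_image, Set.image_preimage_eq_of_subset h]
  exact hV

theorem isPathConnected_preimage_of_subset_range {X Y : Type*} [TopologicalSpace X]
    [TopologicalSpace Y] {f : X → Y} (hf : IsEmbedding f) {V : Set Y} (hV : IsPathConnected V)
    (h : V ⊆ Set.range f) : IsPathConnected (f ⁻¹' V) := by
  rw [hf.isInducing.isPathConnected_iff, Set.image_preimage_eq_of_subset h]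
  exact hV

/-- The cover of a space that is embedded with image `regularSet` by the two sheets. -/
def sheetPair {X : Type*} [TopologicalSpace X] (f : X → (ℝ × ℝ) × ℝ) (hf : IsEmbedding f)
    (hr : Set.range f = regularSet) : SimplyConnectedPair X (Fin 3) where
  V b := f ⁻¹' (if b then upperSheet else lowerSheet)
  isOpen_V b := by
    refine IsOpen.preimage hf.continuous ?_
    cases b
    exacts [isOpen_lowerSheet, isOpen_upperSheet]
  cover x := by
    have : f x ∈ regularSet := hr ▸ Set.mem_range_self x
    rw [regularSet_eq] at this
    rcases this with h | h
    exacts [⟨true, h⟩, ⟨false, h⟩]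
  isSimplyConnected_V b := by
    rw [regularSet_eq] at hr
    cases b
    · exact isSimplyConnected_preimage_of_subset_range hf isSimplyConnected_lowerSheet
        (hr ▸ Set.subset_union_right)
    · exact isSimplyConnected_preimage_of_subset_range hf isSimplyConnected_upperSheet
        (hr ▸ Set.subset_union_left)
  W i :=
    -- Four components: one for the base point and three for generators. Any bijection serves.
    let e : Option (Fin 3) ≃ Bool × Bool := Fintype.equivOfCardEq (by simp)
    f ⁻¹' quadrant (e i).1 (e i).2
  isOpen_W i := (isOpen_quadrant _ _).preimage hf.continuous
  isPathConnected_W i := by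
    refine isPathConnected_preimage_of_subset_range hf (isPathConnected_quadrant _ _) ?_
    intro p hp
    rw [hr, regularSet_eq]
    exact .inl (mem_upperSheet_and_mem_lowerSheet.2 ⟨_, _, hp⟩).1
  mem_iff x := by
    trans f x ∈ upperSheet ∧ f x ∈ lowerSheet
    · simp [and_comm]
    · rw [mem_upperSheet_and_mem_lowerSheet]
      constructor
      · rintro ⟨b, c, h⟩
        refine ⟨(Fintype.equivOfCardEq (by simp) : Option (Fin 3) ≃ Bool × Bool).symm (b, c), ?_⟩
        simpa using h
      · rintro ⟨i, h⟩
        exact ⟨_, _, h⟩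
  disjoint_W i j x hi hj :=
    (Fintype.equivOfCardEq (by simp) : Option (Fin 3) ≃ Bool × Bool).injective
      (quadrant_injective hi hj)

/-! ### The Lax vector -/

/-- The components of the Lax vector at the spectral parameter `z`. -/
def lax (m : PhaseSpace) (z : ℂ) : Fin 3 → ℂ :=
  ![(z ^ 2 - 1 / 4) * (√2 * coordQ m) + 2 * spinU m 0 * (z - 1 / 2) + 2 * spinV m 0 * (z + 1 / 2),
    -(z ^ 2 - 1 / 4) * (√2 * coordP m) + 2 * spinU m 1 * (z - 1 / 2)
      + 2 * spinV m 1 * (z + 1 / 2),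
    (z ^ 2 - 1 / 4) * z + 2 * spinU m 2 * (z - 1 / 2) + 2 * spinV m 2 * (z + 1 / 2)]

/-- The spectral polynomial of a value of the integral map. -/
def spectral (h : ℝ × ℝ × ℝ) (z : ℂ) : ℂ :=
  (z ^ 2 - 1 / 4) ^ 2 * (z ^ 2 + 4 * h.2.2)
    + 4 * (z ^ 2 - 1 / 4) * ((h.1 + h.2.1) * z + (h.2.1 - h.1) / 2) + 8 * z ^ 2 + 2

theorem sphere_sq_sum (x : Sphere2) :
    (x : EuclideanSpace ℝ (Fin 3)) 0 ^ 2 + (x : EuclideanSpace ℝ (Fin 3)) 1 ^ 2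
      + (x : EuclideanSpace ℝ (Fin 3)) 2 ^ 2 = 1 := by
  have h := x.2
  rw [mem_sphere_zero_iff_norm] at h
  have h2 := EuclideanSpace.norm_sq_eq (x : EuclideanSpace ℝ (Fin 3))
  rw [h, Fin.sum_univ_three] at h2
  simp only [Real.norm_eq_abs, sq_abs] at h2
  linarith

theorem stcMap_apply (m : PhaseSpace) : stcMap m =
    (-1 / 2 * spinU m 2 + √2 * (coordQ m * spinU m 0 - coordP m * spinU m 1) - 2 * spinDot m,
      1 / 2 * spinV m 2 + √2 * (coordQ m * spinV m 0 - coordP m * spinV m 1) + 2 * spinDot m,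
      momentumK m) := by
  unfold stcMap integralMap integralH1 integralH2
  norm_num

theorem sum_lax_sq (m : PhaseSpace) (z : ℂ) :
    ∑ i, lax m z i ^ 2 = spectral (stcMap m) z := by
  have hu : (spinU m 0 : ℂ) ^ 2 + (spinU m 1 : ℂ) ^ 2 + (spinU m 2 : ℂ) ^ 2 = 1 := by
    have h : spinU m 0 ^ 2 + spinU m 1 ^ 2 + spinU m 2 ^ 2 = 1 := sphere_sq_sum m.1
    have h' := congrArg Complex.ofReal h
    push_cast at h'
    exact h'
  have hv : (spinV m 0 : ℂ) ^ 2 + (spinV m 1 : ℂ) ^ 2 + (spinV m 2 : ℂ) ^ 2 = 1 := by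
    have h : spinV m 0 ^ 2 + spinV m 1 ^ 2 + spinV m 2 ^ 2 = 1 := sphere_sq_sum m.2.1
    have h' := congrArg Complex.ofReal h
    push_cast at h'
    exact h'
  have h2 : ((√2 : ℝ) : ℂ) ^ 2 = 2 := by exact_mod_cast Real.sq_sqrt (by norm_num : (0 : ℝ) ≤ 2)
  rw [Fin.sum_univ_three, stcMap_apply]
  simp only [lax, spectral, spinDot, momentumK, Matrix.cons_val_zero, Matrix.cons_val_one,
    Matrix.cons_val]
  push_cast
  linear_combination (4 * (z - 1 / 2) ^ 2) * hu + (4 * (z + 1 / 2) ^ 2) * hv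
    + (z ^ 2 - 1 / 4) ^ 2 * ((coordQ m : ℂ) ^ 2 + (coordP m : ℂ) ^ 2) * h2

/-- The scale between the spectral line and the line of the normalized sextics. -/
def scale : ℝ := 8 * delta

theorem scale_pow : scale ^ 3 = 2 := eight_mul_delta_pow

theorem scale_pos : 0 < scale := mul_pos (by norm_num) delta_pos

/-- The parameters of the normalized sextic of a value of the integral map. -/
def parameters : ℝ × ℝ × ℝ ≃ₜ (ℝ × ℝ) × ℝ where
  toFun h := ((2 * (h.1 + h.2.1),
    (4 * h.2.2 + 1 / 4) / scale ^ 2 - (2 * (h.2.1 - h.1) + 8) / scale ^ 4),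
    (2 * (h.2.1 - h.1) + 8) / scale ^ 4)
  invFun p := ((p.1.1 / 2 - (p.2 * scale ^ 4 - 8) / 2) / 2,
    (p.1.1 / 2 + (p.2 * scale ^ 4 - 8) / 2) / 2, ((p.1.2 + p.2) * scale ^ 2 - 1 / 4) / 4)
  left_inv h := by
    have := scale_pos
    ext <;> field_simp <;> ring
  right_inv p := by
    have := scale_pos
    ext <;> field_simp <;> ring
  continuous_toFun := by fun_prop
  continuous_invFun := by fun_prop

/-- Since `scale ^ 3 = 2` and `scale = 8 * delta`, one has `(scale * x) ^ 2 - 1 / 4 = scale ^ 2 * (x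
^ 2 - delta)`; the sextic becomes monic with constant term 1 in `x ^ 2 - delta`. -/
theorem spectral_eq (h : ℝ × ℝ × ℝ) (x : ℂ) : spectral h (scale * x)
    = 4 * sextic (delta : ℂ) (parameters h).1.1 (parameters h).2
      ((parameters h).1.2 + (parameters h).2) x := by
  have hb : (scale : ℂ) ^ 3 = 2 := by exact_mod_cast scale_pow
  have hb0 : (scale : ℂ) ≠ 0 := by exact_mod_cast scale_pos.ne'
  have hd : (delta : ℂ) = scale / 8 := by
    unfold scale
    push_cast
    ring
  have hm : ((scale : ℂ) * x) ^ 2 - 1 / 4 = scale ^ 2 * (x ^ 2 - delta) := by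
    rw [hd]
    linear_combination (1 / 8 : ℂ) * hb
  have e4 : (scale : ℂ) ^ 4 = 2 * scale := by linear_combination (scale : ℂ) * hb
  change (((scale : ℂ) * x) ^ 2 - 1 / 4) ^ 2 * ((scale * x) ^ 2 + 4 * h.2.2)
    + 4 * ((scale * x) ^ 2 - 1 / 4) * ((h.1 + h.2.1) * (scale * x) + (h.2.1 - h.1) / 2)
    + 8 * (scale * x) ^ 2 + 2 = _
  have e1 : ((scale : ℂ) * x) ^ 2 = scale ^ 2 * (x ^ 2 - delta) + 1 / 4 := by rw [← hm]; ring
  have es : ((parameters h).1.1 : ℂ) = 2 * (h.1 + h.2.1) := by simp [parameters]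
  have et : ((parameters h).2 : ℂ) * scale ^ 4 = 2 * (h.2.1 - h.1) + 8 := by
    have : ((parameters h).2 : ℂ) = (2 * (h.2.1 - h.1) + 8) / scale ^ 4 := by simp [parameters]
    rw [this]
    field_simp
  have ek : (((parameters h).1.2 : ℂ) + (parameters h).2) * scale ^ 2 = 4 * h.2.2 + 1 / 4 := by
    have : ((parameters h).1.2 : ℂ) + (parameters h).2 = (4 * h.2.2 + 1 / 4) / scale ^ 2 := by
      simp [parameters]
    rw [this]
    field_simp
  rw [e1]
  unfold sextic
  rw [es]
  generalize ((parameters h).1.2 : ℂ) + (parameters h).2 = k at ek ⊢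
  generalize ((parameters h).2 : ℂ) = t at et ⊢
  generalize x ^ 2 - (delta : ℂ) = m
  generalize (scale : ℂ) = b at *
  linear_combination (m ^ 3 + k * m ^ 2 + t * m) * (b ^ 3 + 2) * hb - b ^ 4 * m ^ 2 * ek
    - b ^ 2 * m * et + 4 * (h.1 + h.2.1) * x * m * hb

theorem spectral_injective {h h' : ℝ × ℝ × ℝ} (e : ∀ z : ℝ, spectral h z = spectral h' z) :
    h = h' := by
  obtain ⟨a, b, c⟩ := h
  obtain ⟨a', b', c'⟩ := h'
  have e0 := e 0
  have e1 := e 1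
  have e2 := e (-1)
  simp only [spectral] at e0 e1 e2
  push_cast at e0 e1 e2
  have hS : (a : ℂ) + b = a' + b' := by linear_combination (e1 - e2) / 6
  have hD : (b : ℂ) - a = b' - a' := by linear_combination -3 / 2 * e0 + (e1 + e2) / 12
  have hc : (c : ℂ) = c' := by linear_combination e0 + (e1 + e2) / 6
  norm_cast at hS hD hc
  ext <;> simp only <;> linarith

/-- The point of the sphere over a point of the unit circle. -/
def sphereMk (a c : ℝ) (h : a ^ 2 + c ^ 2 = 1) : Sphere2 :=
  ⟨!₂[a, 0, c], by
    rw [mem_sphere_zero_iff_norm, EuclideanSpace.norm_eq, Fin.sum_univ_three]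
    simp [h]⟩

/-- The Lax vector is prescribed with second component zero. At `z = -1/2` and `z = 1/2` it is `-2u`
and `2v`, and `spectral` is 4 there, so the spins read off have length one. -/
theorem exists_stcMap_eq_of_spectral {h : ℝ × ℝ × ℝ} {A B C₀ C₁ C₂ : ℝ}
    (e : ∀ z : ℝ, (((z ^ 3 + A * z + B) ^ 2 + (C₂ * z ^ 2 + C₁ * z + C₀) ^ 2 : ℝ) : ℂ)
      = spectral h z) :
    ∃ m, stcMap m = h ∧
      ∀ z, lax m z = ![C₂ * z ^ 2 + C₁ * z + C₀, 0, z ^ 3 + A * z + B] := by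
  have hu : (-(C₂ / 4 - C₁ / 2 + C₀) / 2) ^ 2 + (-(-1 / 8 - A / 2 + B) / 2) ^ 2 = 1 := by
    have h1 : spectral h ((-1 / 2 : ℝ) : ℂ) = (4 : ℝ) := by
      simp only [spectral]
      push_cast
      ring
    have e1 := Complex.ofReal_inj.1 ((e (-1 / 2)).trans h1)
    linear_combination e1 / 4
  have hv : ((C₂ / 4 + C₁ / 2 + C₀) / 2) ^ 2 + ((1 / 8 + A / 2 + B) / 2) ^ 2 = 1 := by
    have h1 : spectral h ((1 / 2 : ℝ) : ℂ) = (4 : ℝ) := by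
      simp only [spectral]
      push_cast
      ring
    have e1 := Complex.ofReal_inj.1 ((e (1 / 2)).trans h1)
    linear_combination e1 / 4
  have hl (z : ℂ) : lax (sphereMk _ _ hu, sphereMk _ _ hv, ⟨0, C₂ / √2⟩) z
      = ![C₂ * z ^ 2 + C₁ * z + C₀, 0, z ^ 3 + A * z + B] := by
    have h2 : ((√2 : ℝ) : ℂ) ≠ 0 := by simp
    funext i
    fin_cases i
    · simp [lax, spinU, spinV, coordQ, sphereMk]
      field_simp
      ring
    · simp [lax, spinU, spinV, coordP, sphereMk]
    · simp [lax, spinU, spinV, sphereMk]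
      ring
  refine ⟨_, spectral_injective fun z => ?_, hl⟩
  rw [← sum_lax_sq, hl, ← e, Fin.sum_univ_three]
  simp
  ring

theorem ofReal_sextic (d s t k x : ℝ) :
    ((sextic d s t k x : ℝ) : ℂ) = sextic (d : ℂ) s t k x := by
  unfold sextic
  push_cast
  ring

theorem exists_stcMap_eq {h : ℝ × ℝ × ℝ} {α β w₀ w₁ w₂ : ℝ}
    (e : ∀ y, sextic delta (parameters h).1.1 (parameters h).2
        ((parameters h).1.2 + (parameters h).2) y
      = (y ^ 3 + α * y + β) ^ 2 + (w₂ * y ^ 2 + w₁ * y + w₀) ^ 2) :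
    ∃ m, stcMap m = h ∧ ∀ y : ℂ, lax m (scale * y)
      = ![2 * (w₂ * y ^ 2 + w₁ * y + w₀), 0, 2 * (y ^ 3 + α * y + β)] := by
  have hb := scale_pos
  have hb3 := scale_pow
  obtain ⟨m, hm, hl⟩ := exists_stcMap_eq_of_spectral (h := h) (A := 2 * α / scale) (B := 2 * β)
    (C₀ := 2 * w₀) (C₁ := 2 * w₁ / scale) (C₂ := 2 * w₂ / scale ^ 2) (fun z => by
      obtain ⟨y, rfl⟩ : ∃ y, z = scale * y := ⟨z / scale, by field_simp⟩
      rw [Complex.ofReal_mul, spectral_eq, ← Complex.ofReal_add, ← ofReal_sextic, e]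
      norm_cast
      have h1 : (scale * y) ^ 3 + 2 * α / scale * (scale * y) + 2 * β
          = 2 * (y ^ 3 + α * y + β) := by
        rw [mul_pow, hb3]
        field_simp
      have h2 : 2 * w₂ / scale ^ 2 * (scale * y) ^ 2 + 2 * w₁ / scale * (scale * y) + 2 * w₀
          = 2 * (w₂ * y ^ 2 + w₁ * y + w₀) := by
        field_simp
      rw [h1, h2]
      ring)
  refine ⟨m, hm, fun y => ?_⟩
  have hbc : (scale : ℂ) ≠ 0 := by exact_mod_cast hb.ne'
  have hb3c : (scale : ℂ) ^ 3 = 2 := by exact_mod_cast hb3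
  rw [hl]
  push_cast
  have h1 : ((scale : ℂ) * y) ^ 3 + 2 * α / scale * (scale * y) + 2 * β
      = 2 * (y ^ 3 + α * y + β) := by
    rw [mul_pow, hb3c]
    field_simp
  have h2 : (2 : ℂ) * w₂ / scale ^ 2 * (scale * y) ^ 2 + 2 * w₁ / scale * (scale * y) + 2 * w₀
      = 2 * (w₂ * y ^ 2 + w₁ * y + w₀) := by
    field_simp
  rw [h1, h2]

open Polynomial in
theorem exists_quadratic_factor {p : ℝ[X]} (hp : ∀ x, p.eval x ≠ 0) {n : ℕ}
    (hn : p.natDegree = n + 2) : ∃ (x a : ℝ) (r : ℝ[X]), r.natDegree = n ∧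
      (∀ y, r.eval y ≠ 0) ∧ ∀ y, p.eval y = ((y - x) ^ 2 + a ^ 2) * r.eval y := by
  obtain ⟨z, hz⟩ := IsAlgClosed.exists_aeval_eq_zero ℂ p (by
    intro h
    have : p.natDegree = 0 := natDegree_eq_of_degree_eq_some h
    omega)
  have hz' : z.im ≠ 0 := by
    intro h
    obtain ⟨x, rfl⟩ : ∃ x : ℝ, z = x := ⟨z.re, Complex.ext rfl (by simp [h])⟩
    refine hp x ?_
    have h2 := aeval_algebraMap_apply ℂ x p
    rw [Complex.coe_algebraMap, hz] at h2
    rw [← coe_aeval_eq_eval]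
    exact_mod_cast h2.symm
  obtain ⟨r, hr⟩ := quadratic_dvd_of_aeval_eq_zero_im_ne_zero _ hz hz'
  have hv (y : ℝ) : p.eval y = ((y - z.re) ^ 2 + z.im ^ 2) * r.eval y := by
    have hn : ‖z‖ ^ 2 = z.re ^ 2 + z.im ^ 2 := by
      rw [← Complex.normSq_eq_norm_sq, Complex.normSq_apply]
      ring
    rw [hr, hn]
    simp
    left
    ring
  refine ⟨z.re, z.im, r, ?_, fun y hy => hp y (by rw [hv, hy, mul_zero]), hv⟩
  have hp0 : p ≠ 0 := by
    rintro rfl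
    simp at hp
  have hr' := hr
  generalize hq : X ^ 2 - C (2 * z.re) * X + C (‖z‖ ^ 2) = q at hr'
  have hq2 : q.natDegree = 2 := by
    rw [← hq]
    compute_degree!
  have h := hn
  rw [hr'] at h hp0
  rw [natDegree_mul (left_ne_zero_of_mul hp0) (right_ne_zero_of_mul hp0), hq2] at h
  omega

theorem exists_factor_of_pos {d s t k : ℝ} (h : ∀ x, 0 < sextic d s t k x) :
    ∃ x₁ x₂ a₁ a₂ a₃ : ℝ, ∀ y, sextic d s t k y = ((y - x₁) ^ 2 + a₁ ^ 2)
      * (((y - x₂) ^ 2 + a₂ ^ 2) * ((y + x₁ + x₂) ^ 2 + a₃ ^ 2)) := by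
  obtain ⟨x₁, a₁, p, hp6, hp, e1⟩ := exists_quadratic_factor (n := 4)
    (fun x => by rw [eval_sexticPoly]; exact (h x).ne') (natDegree_sexticPoly d s t k)
  obtain ⟨x₂, a₂, q, hq6, hq, e2⟩ := exists_quadratic_factor (n := 2) hp hp6
  obtain ⟨x₃, a₃, r, hr6, hr, e3⟩ := exists_quadratic_factor (n := 0) hq hq6
  obtain ⟨α, rfl⟩ := Polynomial.natDegree_eq_zero.1 hr6
  have key (y : ℝ) : sextic d s t k y = ((y - x₁) ^ 2 + a₁ ^ 2)
      * (((y - x₂) ^ 2 + a₂ ^ 2) * (((y - x₃) ^ 2 + a₃ ^ 2) * α)) := by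
    rw [← eval_sexticPoly, e1, e2, e3, Polynomial.eval_C]
  have hcoef (b₁ b₂ b₃ n₁ n₂ n₃ : ℝ) (h : ∀ y, sextic d s t k y = (y ^ 2 + b₁ * y + n₁)
      * ((y ^ 2 + b₂ * y + n₂) * ((y ^ 2 + b₃ * y + n₃) * α))) :
      α = 1 ∧ b₁ + b₂ + b₃ = 0 := by
    obtain ⟨-, -, -, -, -, h5, h6⟩ := eq_zero_of_forall_eval
      (a := -d ^ 3 + k * d ^ 2 - t * d + 1 - n₁ * n₂ * n₃ * α)
      (b := -s * d - (b₁ * n₂ * n₃ + b₂ * n₁ * n₃ + b₃ * n₁ * n₂) * α)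
      (c := 3 * d ^ 2 - 2 * k * d + t - (n₁ * n₂ + n₁ * n₃ + n₂ * n₃ + b₁ * b₂ * n₃
        + b₁ * b₃ * n₂ + b₂ * b₃ * n₁) * α)
      (d := s - (b₁ * b₂ * b₃ + b₁ * (n₂ + n₃) + b₂ * (n₁ + n₃) + b₃ * (n₁ + n₂)) * α)
      (e := -3 * d + k - (n₁ + n₂ + n₃ + b₁ * b₂ + b₁ * b₃ + b₂ * b₃) * α)
      (f := -(b₁ + b₂ + b₃) * α) (g := 1 - α) (fun y => by
        have := h y
        unfold sextic at this
        linear_combination this)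
    obtain rfl : α = 1 := by linarith
    exact ⟨rfl, by linarith⟩
  obtain ⟨rfl, hx⟩ := hcoef (-2 * x₁) (-2 * x₂) (-2 * x₃) (x₁ ^ 2 + a₁ ^ 2) (x₂ ^ 2 + a₂ ^ 2)
    (x₃ ^ 2 + a₃ ^ 2) (fun y => by rw [key]; ring)
  obtain rfl : x₃ = -x₁ - x₂ := by linarith
  exact ⟨x₁, x₂, a₁, a₂, a₃, fun y => by rw [key]; ring⟩

/-- For real `y` a positive sextic is the squared modulus of `∏ (y - xⱼ - i aⱼ)` with `x₁ + x₂ + x₃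
= 0`. The real and imaginary parts of this product are the two components of the Lax vector. -/
theorem exists_stcMap_eq_of_mem {h : ℝ × ℝ × ℝ} (hh : parameters h ∈ positiveSet delta) :
    ∃ m, stcMap m = h := by
  obtain ⟨x₁, x₂, a₁, a₂, a₃, e⟩ := exists_factor_of_pos hh
  obtain ⟨m, hm, -⟩ := exists_stcMap_eq (h := h)
    (α := x₁ * x₂ - (x₁ + x₂) ^ 2 - (a₁ * a₂ + a₁ * a₃ + a₂ * a₃))
    (β := x₁ * x₂ * (x₁ + x₂) - a₁ * a₂ * (x₁ + x₂) + a₁ * a₃ * x₂ + a₂ * a₃ * x₁)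
    (w₂ := -(a₁ + a₂ + a₃)) (w₁ := -a₁ * x₁ - a₂ * x₂ + a₃ * (x₁ + x₂))
    (w₀ := a₁ * a₂ * a₃ + a₁ * x₂ * (x₁ + x₂) + a₂ * x₁ * (x₁ + x₂) - a₃ * x₁ * x₂)
    (fun y => by rw [e]; ring)
  exact ⟨m, hm⟩

/-- If the sextic is `q ^ 2 * ((y + 2 * x) ^ 2 + c ^ 2)`, the components `q * (y + 2 * x)` and `q *
c` vanish together at the roots of `q`. -/
theorem exists_lax_eq_zero {h : ℝ × ℝ × ℝ} (hh : parameters h ∈ positiveSet delta)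
    (hd : HasDoubleRoot delta (parameters h)) : ∃ m, stcMap m = h ∧ ∃ z, lax m z = 0 := by
  obtain ⟨z, h0, h1⟩ := hd
  rw [← Complex.ofReal_add] at h0 h1
  have hz : z.im ≠ 0 := by
    intro hz
    obtain ⟨x, rfl⟩ : ∃ x : ℝ, z = x := ⟨z.re, Complex.ext rfl (by simp [hz])⟩
    rw [← ofReal_sextic, Complex.ofReal_eq_zero] at h0
    exact (hh x).ne' h0
  obtain ⟨n, e, x, hn, he⟩ := exists_factor_of_double_root hz h0 h1
  have hc : 0 ≤ e - 4 * x ^ 2 := by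
    have := hh (-2 * x)
    rw [he] at this
    have h2 := (pos_iff_pos_of_mul_pos this).1
      ((sq_nonneg _).lt_of_ne' (left_ne_zero_of_mul this.ne'))
    linarith
  obtain ⟨c, hc'⟩ : ∃ c, c ^ 2 = e - 4 * x ^ 2 := ⟨_, Real.sq_sqrt hc⟩
  obtain ⟨a, ha⟩ : ∃ a, a ^ 2 = n - x ^ 2 := ⟨_, Real.sq_sqrt (by linarith)⟩
  obtain ⟨m, hm, hl⟩ := exists_stcMap_eq (h := h) (α := n - 4 * x ^ 2) (β := 2 * x * n)
    (w₂ := c) (w₁ := -2 * x * c) (w₀ := n * c)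
    (fun y => by
      rw [he]
      linear_combination -(y ^ 2 - 2 * x * y + n) ^ 2 * hc')
  refine ⟨m, hm, scale * (x + a * Complex.I), ?_⟩
  have hq : ((x : ℂ) + a * Complex.I) ^ 2 - 2 * x * (x + a * Complex.I) + n = 0 := by
    have : (a : ℂ) ^ 2 = n - x ^ 2 := by exact_mod_cast ha
    linear_combination -this + a ^ 2 * Complex.I_sq
  rw [hl]
  push_cast
  funext i
  fin_cases i
  · simp
    linear_combination c * hq
  · simp
  · simp
    linear_combination (x + a * Complex.I + 2 * x) * hq

theorem differentiable_lax (m : PhaseSpace) (i : Fin 3) : Differentiable ℂ (fun z => lax m z i) := by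
  fin_cases i <;> simp [lax] <;> fun_prop

theorem hasDerivAt_sextic (d s t k z : ℂ) :
    HasDerivAt (sextic d s t k) (sexticDeriv d s t k z) z := by
  have h : HasDerivAt (fun x : ℂ => x ^ 2 - d) (2 * z) z := by
    simpa using (hasDerivAt_pow 2 z).sub_const d
  have h1 := ((((h.pow 3).add ((h.pow 2).const_mul k)).add (h.const_mul t)).add_const 1).add
    (((hasDerivAt_id z).const_mul s).mul h)
  refine h1.congr_deriv ?_
  unfold sexticDeriv
  simp
  ring

/-- A sum of squares of functions vanishing at a point has zero derivative there. -/
theorem hasDoubleRoot_of_lax_eq_zero {m : PhaseSpace} {z : ℂ} (h : lax m z = 0) :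
    HasDoubleRoot delta (parameters (stcMap m)) := by
  have hb : (scale : ℂ) ≠ 0 := by exact_mod_cast scale_pos.ne'
  obtain ⟨x, rfl⟩ : ∃ x, z = scale * x := ⟨z / scale, by field_simp⟩
  have h0 : sextic (delta : ℂ) (parameters (stcMap m)).1.1 (parameters (stcMap m)).2
      ((parameters (stcMap m)).1.2 + (parameters (stcMap m)).2) x = 0 := by
    have := spectral_eq (stcMap m) x
    rw [← sum_lax_sq, h] at this
    simpa using this.symm
  refine ⟨x, h0, ?_⟩
  have hd (i : Fin 3) : HasDerivAt (fun y : ℂ => lax m (scale * y) i ^ 2) 0 x := by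
    have h1 : DifferentiableAt ℂ (fun y : ℂ => lax m (scale * y) i) x :=
      ((differentiable_lax m i).comp (differentiable_id.const_mul (scale : ℂ))).differentiableAt
    have := h1.hasDerivAt.fun_pow 2
    rw [h] at this
    simpa using this
  have hs := HasDerivAt.fun_sum (u := Finset.univ) fun i _ => hd i
  simp only [sum_lax_sq, spectral_eq, Finset.sum_const_zero] at hs
  have := hs.unique ((hasDerivAt_sextic _ _ _ _ x).const_mul 4)
  simpa using this.symm

/-- At real spectral parameter the Lax vector is real, so its sum of squares vanishes only with it.
-/
theorem parameters_mem_of_forall_lax_ne_zero {m : PhaseSpace} (h : ∀ z, lax m z ≠ 0) :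
    parameters (stcMap m) ∈ positiveSet delta := by
  intro x
  have hr : ∀ i, ∃ r : ℝ, lax m (scale * x) i = r := by
    intro i
    fin_cases i
    · exact ⟨((scale * x) ^ 2 - 1 / 4) * (√2 * coordQ m) + 2 * spinU m 0 * (scale * x - 1 / 2)
        + 2 * spinV m 0 * (scale * x + 1 / 2), by simp [lax]⟩
    · exact ⟨-((scale * x) ^ 2 - 1 / 4) * (√2 * coordP m) + 2 * spinU m 1 * (scale * x - 1 / 2)
        + 2 * spinV m 1 * (scale * x + 1 / 2), by simp [lax]⟩
    · exact ⟨((scale * x) ^ 2 - 1 / 4) * (scale * x) + 2 * spinU m 2 * (scale * x - 1 / 2)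
        + 2 * spinV m 2 * (scale * x + 1 / 2), by simp [lax]⟩
  choose r hr using hr
  have e := spectral_eq (stcMap m) x
  rw [← sum_lax_sq, ← Complex.ofReal_add, ← ofReal_sextic] at e
  simp only [hr] at e
  norm_cast at e
  have hne : r ≠ 0 := by
    rintro rfl
    exact h (scale * x) (funext fun i => by simp [hr])
  obtain ⟨i, hi⟩ := Function.ne_iff.1 hne
  have : 0 < ∑ i, r i ^ 2 :=
    Finset.sum_pos' (fun i _ => sq_nonneg _) ⟨i, Finset.mem_univ i, by
      have : r i ≠ 0 := hi
      positivity⟩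
  linarith

/-! ### Singular points -/

/-- The ambient space of the phase space. -/
abbrev Ambient : Type := EuclideanSpace ℝ (Fin 3) × EuclideanSpace ℝ (Fin 3) × ℂ

/-- The inclusion of the phase space into its ambient space. -/
def ambient (m : PhaseSpace) : Ambient := (m.1, m.2.1, m.2.2)

/-- The extension of the integral map to the ambient space. -/
def ambientMap (x : Ambient) : ℝ × ℝ × ℝ :=
  (-1 / 2 * x.1 2 + √2 * (x.2.2.im * x.1 0 - x.2.2.re * x.1 1)
      - 2 * (x.1 0 * x.2.1 0 + x.1 1 * x.2.1 1 + x.1 2 * x.2.1 2),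
    1 / 2 * x.2.1 2 + √2 * (x.2.2.im * x.2.1 0 - x.2.2.re * x.2.1 1)
      + 2 * (x.1 0 * x.2.1 0 + x.1 1 * x.2.1 1 + x.1 2 * x.2.1 2),
    x.1 2 + x.2.1 2 + (x.2.2.re ^ 2 + x.2.2.im ^ 2) / 2)

theorem ambientMap_comp : ambientMap ∘ ambient = stcMap := by
  funext m
  rw [stcMap_apply]
  rfl

theorem differentiable_ambientMap : Differentiable ℝ ambientMap := by
  have h1 : Differentiable ℝ fun x : Ambient => x.2.2.re :=
    Complex.reCLM.differentiable.comp (differentiable_snd.comp differentiable_snd)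
  have h2 : Differentiable ℝ fun x : Ambient => x.2.2.im :=
    Complex.imCLM.differentiable.comp (differentiable_snd.comp differentiable_snd)
  unfold ambientMap
  fun_prop

/-- The extension of the Lax vector to the ambient space. -/
def ambientLax (z : ℂ) (x : Ambient) : Fin 3 → ℂ :=
  ![(z ^ 2 - 1 / 4) * (√2 * x.2.2.im) + 2 * x.1 0 * (z - 1 / 2) + 2 * x.2.1 0 * (z + 1 / 2),
    -(z ^ 2 - 1 / 4) * (√2 * x.2.2.re) + 2 * x.1 1 * (z - 1 / 2) + 2 * x.2.1 1 * (z + 1 / 2),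
    (z ^ 2 - 1 / 4) * z + 2 * x.1 2 * (z - 1 / 2) + 2 * x.2.1 2 * (z + 1 / 2)]

theorem ambientLax_apply (m : PhaseSpace) (z : ℂ) : ambientLax z (ambient m) = lax m z := rfl

theorem differentiable_ambientLax (z : ℂ) : Differentiable ℝ (ambientLax z) := by
  have hc {f : Ambient → ℝ} (hf : Differentiable ℝ f) :
      Differentiable ℝ fun x => (f x : ℂ) := Complex.ofRealCLM.differentiable.comp hf
  have h1 : Differentiable ℝ fun x : Ambient => (x.2.2.re : ℂ) :=
    hc (Complex.reCLM.differentiable.comp (differentiable_snd.comp differentiable_snd))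
  have h2 : Differentiable ℝ fun x : Ambient => (x.2.2.im : ℂ) :=
    hc (Complex.imCLM.differentiable.comp (differentiable_snd.comp differentiable_snd))
  have h3 (i : Fin 3) : Differentiable ℝ fun x : Ambient => (x.1 i : ℂ) := hc (by fun_prop)
  have h4 (i : Fin 3) : Differentiable ℝ fun x : Ambient => (x.2.1 i : ℂ) := hc (by fun_prop)
  rw [differentiable_pi]
  intro i
  fin_cases i <;> simp [ambientLax] <;> fun_prop

/-- The differential of the inclusion of the sphere. -/
abbrev sphereInclusionDeriv (u : Sphere2) :
    TangentSpace (𝓡 2) u →L[ℝ] EuclideanSpace ℝ (Fin 3) :=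
  mfderiv (𝓡 2) 𝓘(ℝ, EuclideanSpace ℝ (Fin 3))
    ((↑) : Sphere2 → EuclideanSpace ℝ (Fin 3)) u

theorem hasMFDerivAt_coe_sphere (u : Sphere2) :
    HasMFDerivAt (𝓡 2) 𝓘(ℝ, EuclideanSpace ℝ (Fin 3))
      ((↑) : Sphere2 → EuclideanSpace ℝ (Fin 3)) u (sphereInclusionDeriv u) := by
  refine MDifferentiableAt.hasMFDerivAt ?_
  have := Fact.mk (@finrank_euclideanSpace_fin ℝ _ (2 + 1))
  exact (contMDiff_coe_sphere (E := EuclideanSpace ℝ (Fin (2 + 1))) (n := 2) (m := 1)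
    u).mdifferentiableAt one_ne_zero

theorem range_sphereInclusionDeriv (u : Sphere2) :
    LinearMap.range (sphereInclusionDeriv u : TangentSpace (𝓡 2) u →ₗ[ℝ] EuclideanSpace ℝ (Fin 3))
      = (ℝ ∙ (u : EuclideanSpace ℝ (Fin 3)))ᗮ := by
  have := Fact.mk (@finrank_euclideanSpace_fin ℝ _ (2 + 1))
  exact range_mvfderiv_subtypeVal (E := EuclideanSpace ℝ (Fin (2 + 1))) (n := 2) u

theorem hasMFDerivAt_prodMk {E F : Type*} [NormedAddCommGroup E] [NormedSpace ℝ E]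
    [NormedAddCommGroup F] [NormedSpace ℝ F] {f : PhaseSpace → E} {g : PhaseSpace → F}
    {m : PhaseSpace} {f' : TangentSpace phaseModel m →L[ℝ] E}
    {g' : TangentSpace phaseModel m →L[ℝ] F} (hf : HasMFDerivAt phaseModel 𝓘(ℝ, E) f m f')
    (hg : HasMFDerivAt phaseModel 𝓘(ℝ, F) g m g') :
    HasMFDerivAt phaseModel 𝓘(ℝ, E × F) (fun x => (f x, g x)) m (f'.prod g') :=
  ⟨hf.1.prodMk hg.1, hf.2.prodMk hg.2⟩

/-- The differential of the inclusion of the phase space into its ambient space. -/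
def ambientDeriv (m : PhaseSpace) : TangentSpace phaseModel m →L[ℝ] Ambient :=
  ((sphereInclusionDeriv m.1).comp (ContinuousLinearMap.fst ℝ _ _)).prod
    (((sphereInclusionDeriv m.2.1).comp
      ((ContinuousLinearMap.fst ℝ _ _).comp (ContinuousLinearMap.snd ℝ _ _))).prod
      ((ContinuousLinearMap.snd ℝ _ _).comp (ContinuousLinearMap.snd ℝ _ _)))

theorem hasMFDerivAt_ambient (m : PhaseSpace) :
    HasMFDerivAt phaseModel 𝓘(ℝ, Ambient) ambient m (ambientDeriv m) :=
  hasMFDerivAt_prodMk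
    ((hasMFDerivAt_coe_sphere m.1).comp m (hasMFDerivAt_fst (I' := (𝓡 2).prod 𝓘(ℝ, ℂ)) m))
    (hasMFDerivAt_prodMk
      ((hasMFDerivAt_coe_sphere m.2.1).comp m
        ((hasMFDerivAt_fst (I := 𝓡 2) (I' := 𝓘(ℝ, ℂ)) m.2).comp m
          (hasMFDerivAt_snd (I := 𝓡 2) m)))
      ((hasMFDerivAt_snd (I := 𝓡 2) (I' := 𝓘(ℝ, ℂ)) m.2).comp m (hasMFDerivAt_snd (I := 𝓡 2) m)))

/-- The differential of the integral map. -/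
def stcDeriv (m : PhaseSpace) : TangentSpace phaseModel m →L[ℝ] ℝ × ℝ × ℝ :=
  (fderiv ℝ ambientMap (ambient m)).comp (ambientDeriv m)

theorem hasMFDerivAt_stcMap (m : PhaseSpace) :
    HasMFDerivAt phaseModel 𝓘(ℝ, ℝ × ℝ × ℝ) stcMap m (stcDeriv m) := by
  rw [← ambientMap_comp]
  exact (differentiable_ambientMap _).hasFDerivAt.hasMFDerivAt.comp m (hasMFDerivAt_ambient m)

theorem exists_ambientDeriv_eq (m : PhaseSpace) {ξ η : EuclideanSpace ℝ (Fin 3)} (c : ℂ)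
    (hξ : inner ℝ (spinU m) ξ = 0) (hη : inner ℝ (spinV m) η = 0) :
    ∃ w, ambientDeriv m w = (ξ, η, c) := by
  have h1 : ξ ∈ LinearMap.range (sphereInclusionDeriv m.1 :
      TangentSpace (𝓡 2) m.1 →ₗ[ℝ] EuclideanSpace ℝ (Fin 3)) := by
    rw [range_sphereInclusionDeriv]
    exact Submodule.mem_orthogonal_singleton_iff_inner_right.2 hξ
  have h2 : η ∈ LinearMap.range (sphereInclusionDeriv m.2.1 :
      TangentSpace (𝓡 2) m.2.1 →ₗ[ℝ] EuclideanSpace ℝ (Fin 3)) := by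
    rw [range_sphereInclusionDeriv]
    exact Submodule.mem_orthogonal_singleton_iff_inner_right.2 hη
  obtain ⟨a, ha⟩ := h1
  obtain ⟨b, hb⟩ := h2
  exact ⟨(a, b, c), Prod.ext ha (Prod.ext hb rfl)⟩

/-- The linear part of the dependence of the spectral polynomial on the integrals. -/
def spectralLinear (z : ℂ) : ℝ × ℝ × ℝ →ₗ[ℝ] ℂ where
  toFun h := 4 * (z ^ 2 - 1 / 4) * (h.1 * (z - 1 / 2) + h.2.1 * (z + 1 / 2)
    + (z ^ 2 - 1 / 4) * h.2.2)
  map_add' h h' := by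
    simp
    ring
  map_smul' a h := by
    simp
    ring

theorem spectral_eq_linear (z : ℂ) (h : ℝ × ℝ × ℝ) : spectral h z
    = spectralLinear z h + ((z ^ 2 - 1 / 4) ^ 2 * z ^ 2 + 8 * z ^ 2 + 2) := by
  simp only [spectral, spectralLinear, LinearMap.coe_mk, AddHom.coe_mk]
  ring

/-- For fixed `z` the sum of squares is an affine function of the integrals; as a function on phase
space it is critical where the Lax vector vanishes. -/
theorem spectralLinear_comp_mfderiv {m : PhaseSpace} {z : ℂ} (h : lax m z = 0) :
    (spectralLinear z).toContinuousLinearMap.comp (stcDeriv m) = 0 := by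
  have h1 : HasFDerivAt (fun y => spectralLinear z y
      + ((z ^ 2 - 1 / 4) ^ 2 * z ^ 2 + 8 * z ^ 2 + 2))
      (spectralLinear z).toContinuousLinearMap (stcMap m) :=
    ((spectralLinear z).toContinuousLinearMap.hasFDerivAt).add_const _
  have h2 := h1.hasMFDerivAt.comp m (hasMFDerivAt_stcMap m)
  have h3 : HasFDerivAt (fun w : Fin 3 → ℂ => ∑ i, w i ^ 2) (0 : (Fin 3 → ℂ) →L[ℝ] ℂ)
      (ambientLax z (ambient m)) := by
    rw [ambientLax_apply, h]
    have (i : Fin 3) : HasFDerivAt (fun w : Fin 3 → ℂ => w i ^ 2) (0 : (Fin 3 → ℂ) →L[ℝ] ℂ) 0 := by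
      have := (hasFDerivAt_apply (𝕜 := ℝ) i (0 : Fin 3 → ℂ)).pow 2
      refine this.congr_fderiv ?_
      ext
      simp
    simpa using HasFDerivAt.fun_sum (u := Finset.univ) fun i _ => this i
  have h4 := (h3.comp _ (differentiable_ambientLax z (ambient m)).hasFDerivAt).hasMFDerivAt.comp m
    (hasMFDerivAt_ambient m)
  have e : (fun y => spectralLinear z y + ((z ^ 2 - 1 / 4) ^ 2 * z ^ 2 + 8 * z ^ 2 + 2)) ∘ stcMap
      = ((fun w : Fin 3 → ℂ => ∑ i, w i ^ 2) ∘ ambientLax z) ∘ ambient := by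
    funext m'
    simp only [Function.comp_apply]
    rw [← spectral_eq_linear, ambientLax_apply, sum_lax_sq]
  rw [e] at h2
  refine (hasMFDerivAt_unique h2 h4).trans ?_
  ext
  rfl

theorem isSingularPoint_iff (m : PhaseSpace) : IsSingularPoint stcMap m ↔
    LinearMap.range (stcDeriv m : TangentSpace phaseModel m →ₗ[ℝ] ℝ × ℝ × ℝ) ≠ ⊤ := by
  unfold IsSingularPoint differentialRank
  rw [(hasMFDerivAt_stcMap m).mfderiv]
  change Module.finrank ℝ
    (LinearMap.range (stcDeriv m : TangentSpace phaseModel m →ₗ[ℝ] ℝ × ℝ × ℝ)) < 3 ↔ _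
  have h3 : Module.finrank ℝ (ℝ × ℝ × ℝ) = 3 := by simp
  constructor
  · intro h h'
    rw [h', finrank_top] at h
    exact absurd h3 h.ne
  · intro h
    have := Submodule.finrank_lt h
    rwa [h3] at this

theorem isSingularPoint_of_lax_eq_zero {m : PhaseSpace} {z : ℂ} (h : lax m z = 0) :
    IsSingularPoint stcMap m := by
  rw [isSingularPoint_iff]
  intro htop
  -- At `z ^ 2 = 1 / 4` the spectral polynomial is 4, so the Lax vector cannot vanish there. This
  -- keeps `spectralLinear z` from being zero.
  have hz : z ^ 2 - 1 / 4 ≠ 0 := by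
    intro hz
    have hs := sum_lax_sq m z
    rw [h] at hs
    simp only [spectral, hz] at hs
    simp at hs
    have : z ^ 2 = 1 / 4 := by linear_combination hz
    rw [this] at hs
    norm_num at hs
  have h1 : ((1 : ℝ), (0 : ℝ), (0 : ℝ))
      ∈ LinearMap.range (stcDeriv m : TangentSpace phaseModel m →ₗ[ℝ] ℝ × ℝ × ℝ) := by
    rw [htop]
    trivial
  obtain ⟨w, hw⟩ := h1
  have h2 := DFunLike.congr_fun (spectralLinear_comp_mfderiv h) w
  have h3 : spectralLinear z (1, 0, 0) = 0 := by
    rw [← hw]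
    exact h2
  simp only [spectralLinear, LinearMap.coe_mk, AddHom.coe_mk] at h3
  simp at h3
  rcases h3 with h3 | h3
  · apply hz
    simpa using h3
  · apply hz
    linear_combination (z + 1 / 2) * h3

open Polynomial in
/-- A polynomial has a root of larger multiplicity than in a nonzero polynomial of smaller
degree. -/
theorem exists_common_root {Z N : ℂ[X]} (hN : N ≠ 0) (hdeg : N.natDegree < Z.natDegree) :
    ∃ z, Z.eval z = 0 ∧ ∀ Y A : ℂ[X], N * Y = A * Z → Y.eval z = 0 := by
  have hZ : Z ≠ 0 := by
    rintro rfl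
    simp at hdeg
  obtain ⟨z, hz⟩ : ∃ z, N.rootMultiplicity z < Z.rootMultiplicity z := by
    by_contra! hle
    have h1 : Z.roots ≤ N.roots := Multiset.le_iff_count.2 fun z => by
      rw [count_roots, count_roots]
      exact hle z
    have h2 := Multiset.card_le_card h1
    rw [(IsAlgClosed.splits Z).natDegree_eq_card_roots.symm,
      (IsAlgClosed.splits N).natDegree_eq_card_roots.symm] at h2
    omega
  refine ⟨z, (rootMultiplicity_pos hZ).1 (by omega), fun Y A h => ?_⟩
  by_cases hY : Y = 0
  · simp [hY]
  have hNY := mul_ne_zero hN hY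
  have h1 := rootMultiplicity_mul (x := z) hNY
  rw [h] at h1 hNY
  rw [rootMultiplicity_mul hNY] at h1
  exact (rootMultiplicity_pos hY).1 (by omega)

theorem fderiv_ambientMap (x w : Ambient) : fderiv ℝ ambientMap x w =
    (-1 / 2 * w.1 2 + √2 * (w.2.2.im * x.1 0 + x.2.2.im * w.1 0 - w.2.2.re * x.1 1
        - x.2.2.re * w.1 1) - 2 * (w.1 0 * x.2.1 0 + w.1 1 * x.2.1 1 + w.1 2 * x.2.1 2
        + x.1 0 * w.2.1 0 + x.1 1 * w.2.1 1 + x.1 2 * w.2.1 2),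
      1 / 2 * w.2.1 2 + √2 * (w.2.2.im * x.2.1 0 + x.2.2.im * w.2.1 0 - w.2.2.re * x.2.1 1
        - x.2.2.re * w.2.1 1) + 2 * (w.1 0 * x.2.1 0 + w.1 1 * x.2.1 1 + w.1 2 * x.2.1 2
        + x.1 0 * w.2.1 0 + x.1 1 * w.2.1 1 + x.1 2 * w.2.1 2),
      w.1 2 + w.2.1 2 + x.2.2.re * w.2.2.re + x.2.2.im * w.2.2.im) := by
  have h1 : HasDerivAt (fun t : ℝ => ambientMap (x + t • w)) (fderiv ℝ ambientMap x w) 0 := by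
    have h2 : HasDerivAt (fun t : ℝ => x + t • w) w 0 := by
      simpa using ((hasDerivAt_id (0 : ℝ)).smul_const w).const_add x
    have h3 := (differentiable_ambientMap (x + (0 : ℝ) • w)).hasFDerivAt.comp_hasDerivAt 0 h2
    rw [zero_smul, add_zero] at h3
    exact h3
  -- `ambientMap` is quadratic, so its derivative along a line is the linear coefficient.
  have h4 {f : ℝ → ℝ} (a b c : ℝ) (h : ∀ t, f t = a + b * t + c * t ^ 2) : HasDerivAt f b 0 := by
    rw [funext h]
    have := (((hasDerivAt_id (0 : ℝ)).const_mul b).const_add a).fun_add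
      ((hasDerivAt_pow 2 (0 : ℝ)).const_mul c)
    simpa using this
  refine h1.unique (HasDerivAt.prodMk (h4
    (-1 / 2 * x.1 2 + √2 * (x.2.2.im * x.1 0 - x.2.2.re * x.1 1)
      - 2 * (x.1 0 * x.2.1 0 + x.1 1 * x.2.1 1 + x.1 2 * x.2.1 2)) _
    (√2 * (w.2.2.im * w.1 0 - w.2.2.re * w.1 1)
      - 2 * (w.1 0 * w.2.1 0 + w.1 1 * w.2.1 1 + w.1 2 * w.2.1 2)) fun t => ?_) (HasDerivAt.prodMk (h4
    (1 / 2 * x.2.1 2 + √2 * (x.2.2.im * x.2.1 0 - x.2.2.re * x.2.1 1)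
      + 2 * (x.1 0 * x.2.1 0 + x.1 1 * x.2.1 1 + x.1 2 * x.2.1 2)) _
    (√2 * (w.2.2.im * w.2.1 0 - w.2.2.re * w.2.1 1)
      + 2 * (w.1 0 * w.2.1 0 + w.1 1 * w.2.1 1 + w.1 2 * w.2.1 2)) fun t => ?_) (h4
    (x.1 2 + x.2.1 2 + (x.2.2.re ^ 2 + x.2.2.im ^ 2) / 2) _
    ((w.2.2.re ^ 2 + w.2.2.im ^ 2) / 2) fun t => ?_)))
  all_goals
    simp
    ring

/-- The equations of a covector annihilating the image of the differential. -/
theorem exists_covector {m : PhaseSpace} (h : IsSingularPoint stcMap m) :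
    ∃ c : ℝ × ℝ × ℝ, c ≠ 0 ∧
      √2 * (c.1 * spinU m 0 + c.2.1 * spinV m 0) + c.2.2 * coordQ m = 0 ∧
      -√2 * (c.1 * spinU m 1 + c.2.1 * spinV m 1) + c.2.2 * coordP m = 0 ∧
      spinU m 1 * (-c.1 / 2 + 2 * (c.2.1 - c.1) * spinV m 2 + c.2.2)
        - spinU m 2 * (-c.1 * √2 * coordP m + 2 * (c.2.1 - c.1) * spinV m 1) = 0 ∧
      spinU m 2 * (c.1 * √2 * coordQ m + 2 * (c.2.1 - c.1) * spinV m 0)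
        - spinU m 0 * (-c.1 / 2 + 2 * (c.2.1 - c.1) * spinV m 2 + c.2.2) = 0 ∧
      spinV m 1 * (c.2.1 / 2 + 2 * (c.2.1 - c.1) * spinU m 2 + c.2.2)
        - spinV m 2 * (-c.2.1 * √2 * coordP m + 2 * (c.2.1 - c.1) * spinU m 1) = 0 ∧
      spinV m 2 * (c.2.1 * √2 * coordQ m + 2 * (c.2.1 - c.1) * spinU m 0)
        - spinV m 0 * (c.2.1 / 2 + 2 * (c.2.1 - c.1) * spinU m 2 + c.2.2) = 0 := by
  rw [isSingularPoint_iff] at h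
  obtain ⟨φ, hφ, hle⟩ := Submodule.exists_le_ker_of_lt_top _ (lt_top_iff_ne_top.2 h)
  have hφa (a b c : ℝ) : φ (a, b, c) = φ (1, 0, 0) * a + φ (0, 1, 0) * b + φ (0, 0, 1) * c := by
    have : (a, b, c) = a • ((1 : ℝ), (0 : ℝ), (0 : ℝ)) + b • ((0 : ℝ), (1 : ℝ), (0 : ℝ))
        + c • ((0 : ℝ), (0 : ℝ), (1 : ℝ)) := by simp
    rw [this]
    simp only [map_add, map_smul, smul_eq_mul]
    ring
  have key (ξ η : EuclideanSpace ℝ (Fin 3)) (c : ℂ) (hξ : inner ℝ (spinU m) ξ = 0)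
      (hη : inner ℝ (spinV m) η = 0) : φ (fderiv ℝ ambientMap (ambient m) (ξ, η, c)) = 0 := by
    obtain ⟨w, hw⟩ := exists_ambientDeriv_eq m c hξ hη
    have : stcDeriv m w ∈ LinearMap.ker φ := hle ⟨w, rfl⟩
    rw [← hw]
    exact this
  refine ⟨(φ (1, 0, 0), φ (0, 1, 0), φ (0, 0, 1)), ?_, ?_, ?_, ?_, ?_, ?_, ?_⟩
  · intro h0
    apply hφ
    simp only [Prod.mk_eq_zero] at h0
    refine LinearMap.ext fun ⟨a, b, c⟩ => ?_
    rw [hφa, h0.1, h0.2.1, h0.2.2]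
    simp
  · have := key 0 0 Complex.I (by simp) (by simp)
    rw [fderiv_ambientMap, hφa] at this
    simp [ambient] at this
    simp only [spinU, spinV, coordQ]
    linear_combination this
  · have := key 0 0 1 (by simp) (by simp)
    rw [fderiv_ambientMap, hφa] at this
    simp [ambient] at this
    simp only [spinU, spinV, coordP]
    linear_combination this
  -- The remaining test vectors are infinitesimal rotations of one spin about the first or the
  -- second axis.
  · have := key !₂[0, -spinU m 2, spinU m 1] 0 0
      (by simp [PiLp.inner_apply, Fin.sum_univ_three]; ring) (by simp)
    rw [fderiv_ambientMap, hφa] at this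
    simp [ambient] at this
    simp only [spinU, spinV, coordP] at this ⊢
    linear_combination this
  · have := key !₂[spinU m 2, 0, -spinU m 0] 0 0
      (by simp [PiLp.inner_apply, Fin.sum_univ_three]; ring) (by simp)
    rw [fderiv_ambientMap, hφa] at this
    simp [ambient] at this
    simp only [spinU, spinV, coordQ] at this ⊢
    linear_combination this
  · have := key 0 !₂[0, -spinV m 2, spinV m 1] 0 (by simp)
      (by simp [PiLp.inner_apply, Fin.sum_univ_three]; ring)
    rw [fderiv_ambientMap, hφa] at this
    simp [ambient] at this
    simp only [spinU, spinV, coordP] at this ⊢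
    linear_combination this
  · have := key 0 !₂[spinV m 2, 0, -spinV m 0] 0 (by simp)
      (by simp [PiLp.inner_apply, Fin.sum_univ_three]; ring)
    rw [fderiv_ambientMap, hφa] at this
    simp [ambient] at this
    simp only [spinU, spinV, coordQ] at this ⊢
    linear_combination this

open Polynomial in
-- The covector equations make the polynomial vectors `A` and `L` proportional. Since `A 2` has
-- degree at most 2 and `L 2` has degree 3, some root of `L 2` has larger multiplicity there than in
-- `A 2`, and all components of `L` vanish at it.
theorem exists_lax_eq_zero_of_isSingularPoint {m : PhaseSpace} (h : IsSingularPoint stcMap m) :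
    ∃ z, lax m z = 0 := by
  obtain ⟨⟨c₁, c₂, c₃⟩, hc, eq, ep, u0, u1, v0, v1⟩ := exists_covector h
  simp only at eq ep u0 u1 v0 v1
  have hu : spinU m 0 ^ 2 + spinU m 1 ^ 2 + spinU m 2 ^ 2 = 1 := sphere_sq_sum m.1
  have hv : spinV m 0 ^ 2 + spinV m 1 ^ 2 + spinV m 2 ^ 2 = 1 := sphere_sq_sum m.2.1
  have h2 : √2 ^ 2 = 2 := Real.sq_sqrt (by norm_num)
  set A : Fin 3 → ℂ[X] := fun i => C ((c₁ * spinU m i : ℝ) : ℂ) * (X - C (1 / 2))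
    + C ((c₂ * spinV m i : ℝ) : ℂ) * (X + C (1 / 2))
    - C (if i = 2 then (c₃ : ℂ) / 2 else 0) * (X ^ 2 - C (1 / 4)) with hA
  set L : Fin 3 → ℂ[X] := fun i =>
    (X ^ 2 - C (1 / 4)) * ![C ((√2 * coordQ m : ℝ) : ℂ), C ((-√2 * coordP m : ℝ) : ℂ), X] i
    + C ((2 * spinU m i : ℝ) : ℂ) * (X - C (1 / 2))
    + C ((2 * spinV m i : ℝ) : ℂ) * (X + C (1 / 2)) with hL
  have hLe (z : ℂ) (i : Fin 3) : (L i).eval z = lax m z i := by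
    fin_cases i <;> simp [hL, lax]
    ring
  have hAe (z : ℂ) (i : Fin 3) : (A i).eval z = c₁ * spinU m i * (z - 1 / 2)
      + c₂ * spinV m i * (z + 1 / 2) - (if i = 2 then (c₃ : ℂ) / 2 else 0) * (z ^ 2 - 1 / 4) := by
    simp [hA]
  have h0 : A 2 * L 0 = A 0 * L 2 := by
    refine Polynomial.funext fun z => ?_
    simp only [eval_mul, hAe, hLe, lax, Matrix.cons_val_zero, Matrix.cons_val]
    have h2 := congrArg Complex.ofReal h2
    have eq := congrArg Complex.ofReal eq
    have u1 := congrArg Complex.ofReal u1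
    have v1 := congrArg Complex.ofReal v1
    push_cast at h2 eq u1 v1
    simp
    linear_combination (z ^ 2 - 1 / 4) * ((z - 1 / 2) * u1 + (z + 1 / 2) * v1
      - (z ^ 2 - 1 / 4) * √2 / 2 * eq)
      + (z ^ 2 - 1 / 4) ^ 2 / 2 * (c₁ * spinU m 0 + c₂ * spinV m 0) * h2
  have h1 : A 2 * L 1 = A 1 * L 2 := by
    refine Polynomial.funext fun z => ?_
    simp only [eval_mul, hAe, hLe, lax, Matrix.cons_val_one, Matrix.cons_val]
    have h2 := congrArg Complex.ofReal h2
    have ep := congrArg Complex.ofReal ep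
    have u0 := congrArg Complex.ofReal u0
    have v0 := congrArg Complex.ofReal v0
    push_cast at h2 ep u0 v0
    simp
    linear_combination (-1 : ℂ) * (z ^ 2 - 1 / 4) * ((z - 1 / 2) * u0 + (z + 1 / 2) * v0
      - (z ^ 2 - 1 / 4) * √2 / 2 * ep)
      + (z ^ 2 - 1 / 4) ^ 2 / 2 * (c₁ * spinU m 1 + c₂ * spinV m 1) * h2
  have hdL : (L 2).natDegree = 3 := by
    simp only [hL, Matrix.cons_val]
    compute_degree!
  have hdA : (A 2).natDegree ≤ 2 := by
    simp only [hA]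
    compute_degree
  have hL0 : L 2 ≠ 0 := by
    intro h
    simp [h] at hdL
  -- Otherwise all of `A` is zero, and its values at `1/2`, `-1/2` and `0` kill the covector,
  -- because the spins are not zero.
  have hA0 : A 2 ≠ 0 := by
    intro hA2
    rw [hA2, zero_mul] at h0 h1
    have hA0 := (mul_eq_zero.1 h0.symm).resolve_right hL0
    have hA1 := (mul_eq_zero.1 h1.symm).resolve_right hL0
    have hall (i : Fin 3) : A i = 0 := by
      fin_cases i
      exacts [hA0, hA1, hA2]
    have hc2 (i : Fin 3) : c₂ * spinV m i = 0 := by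
      have := hAe (1 / 2) i
      rw [hall] at this
      norm_num at this
      simpa using this
    have hc1 (i : Fin 3) : c₁ * spinU m i = 0 := by
      have := hAe (-1 / 2) i
      rw [hall] at this
      norm_num at this
      simpa using this
    have hc3 : c₃ = 0 := by
      have := hAe 0 2
      rw [hall, ← Complex.ofReal_mul, ← Complex.ofReal_mul, hc1, hc2] at this
      simpa using this
    apply hc
    simp only [Prod.mk_eq_zero]
    refine ⟨?_, ?_, hc3⟩
    · linear_combination -c₁ * hu + spinU m 0 * hc1 0 + spinU m 1 * hc1 1 + spinU m 2 * hc1 2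
    · linear_combination -c₂ * hv + spinV m 0 * hc2 0 + spinV m 1 * hc2 1 + spinV m 2 * hc2 2
  obtain ⟨z, hz, hY⟩ := exists_common_root hA0 (hdA.trans_lt (by rw [hdL]; norm_num))
  refine ⟨z, funext fun i => ?_⟩
  rw [← hLe]
  fin_cases i
  exacts [hY _ _ h0, hY _ _ h1, hz]

/-! ### The regular values -/

/-- A given point over a value with a double root need not have a Lax zero. `exists_lax_eq_zero`
supplies another point of the same fibre that does, which suffices for a critical value. -/
theorem mem_regularValues_iff (h : ℝ × ℝ × ℝ) :
    h ∈ regularValues stcMap ↔ parameters h ∈ regularSet := by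
  constructor
  · rintro ⟨⟨m, rfl⟩, hcrit⟩
    have hne (m' : PhaseSpace) (hm : stcMap m' = stcMap m) (z : ℂ) : lax m' z ≠ 0 := fun hz =>
      hcrit ⟨m', isSingularPoint_of_lax_eq_zero hz, hm⟩
    have hpos := parameters_mem_of_forall_lax_ne_zero (hne m rfl)
    refine ⟨hpos, fun hd => ?_⟩
    obtain ⟨m', hm, z, hz⟩ := exists_lax_eq_zero hpos hd
    exact hne m' hm z hz
  · rintro ⟨hpos, hd⟩
    refine ⟨exists_stcMap_eq_of_mem hpos, ?_⟩
    rintro ⟨m, hm, rfl⟩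
    obtain ⟨z, hz⟩ := exists_lax_eq_zero_of_isSingularPoint hm
    exact hd (hasDoubleRoot_of_lax_eq_zero hz)

/-- The two sheets of the regular values. -/
def regularValuesPair : SimplyConnectedPair (regularValues stcMap) (Fin 3) :=
  sheetPair (fun h => parameters h.1)
    (parameters.isEmbedding.comp Topology.IsEmbedding.subtypeVal) (by
      ext p
      constructor
      · rintro ⟨h, rfl⟩
        exact (mem_regularValues_iff _).1 h.2
      · intro hp
        refine ⟨⟨parameters.symm p, ?_⟩, parameters.apply_symm_apply p⟩
        rwa [mem_regularValues_iff, parameters.apply_symm_apply])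

end TavisCummings

end

theorem mainTheorem3 :
    IsPathConnected (TavisCummings.regularValues TavisCummings.stcMap) ∧
      ∀ r₀ : TavisCummings.regularValues TavisCummings.stcMap,
        Nonempty (FundamentalGroup (TavisCummings.regularValues TavisCummings.stcMap) r₀ ≃*
          FreeGroup (Fin 3)) :=
  ⟨isPathConnected_iff_pathConnectedSpace.2 TavisCummings.regularValuesPair.pathConnectedSpace,
    fun r₀ => TavisCummings.regularValuesPair.nonempty_mulEquiv r₀⟩
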